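/- **Setting.** Let $n\ge 3$ and let $0,1,\infty,z_1,\dots,z_{n-3}$ be $n$ distinct points of the Riemann sphere (the punctures), and let $R$ be the complement of these points. Let $A(R)$ be the space of holomorphic functions $\varphi$ on $R$ with $\|\varphi\|=\int_{\mathbb C}|\varphi|<\infty$ (integrable holomorphic quadratic differentials $\varphi\,dz^2$), and let $\varphi_k(z)=\eta_k/(z(z-1)(z-z_k))$, $1\le k\le n-3$, where $\eta_k>0$ is chosen such that $\|\varphi_k\|=1$. Beltrami differentials are elements of $L^\infty(\mathbb C)$ with the $L^\infty$ norm; $\mu$ and $\nu$ are infinitesimally equivalent if $\int\mu\varphi=\int\nu\varphi$ for all $\varphi\in A(R)$ with $\|\varphi\|=1$. Write $\nu=\mathcal P(\mu)$ if $\nu$ has the least norm among all Beltrami differentials that are infinitesimally equivalent to $\mu$. **Triangulations.** A triangulation is a finite triangulation of the sphere whose edges between finite vertices are straight segments and whose edges to $\infty$ are radial rays. It contains a segment or ray if the latter lies in the union of its edges. For $c>0$ and $0<\delta<1$, a canonical triangulation $\Delta_\varepsilon$ of size $\varepsilon$ is a triangulation that has all punctures as vertices and satisfies: (1) it contains the vertices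 and edges of a regular polygon centered at $0$ of circumdiameter at least $1/(c\delta)$, and the rays from its vertices to $\infty$; (2) all edges not ending at $\infty$ have length at most $\varepsilon$; (3) around each finite puncture it contains the vertices and edges of a regular polygon centered there, of circumdiameter at most $c\delta$ and with at least $\delta^{1-2n}/c$ sides, and the segments from its vertices to the puncture; (4) it is a refinement of a triangulation of size $1/2$ that has all punctures as vertices and contains such polygons, rays and segments for some choice of diameters and numbers of sides. **Algorithm INEXT.** The input is a triangulation with faces $t_1,\dots,t_T$ and a piecewise constant $\mu$ with value $\mu_j$ on $t_j$. INEXT forms the matrix $A=(\int_{t_j}\varphi_i)_{ij}=A_r+iA_i$ and the vector $b=A(\mu_j)_j=b_r+ib_i$, and returns the piecewise constant $\hat\nu$ with values $\lambda_{r,j}+i\lambda_{i,j}$ on $t_j$ for an optimal solution $(\lambda_r,\lambda_i,\zeta)\in\mathbb R^{2T+1}$ of the quadratically constrained program $$\min \zeta\quad\text{subject to}\quad A_r\lambda_r-A_i\lambda_i=b_r,\quad A_i\lambda_r+A_r\lambda_i=b_i,\quad \lambda_{r,j}^2+\lambda_{i,j}^2-\zeta\le 0\ \ (1\le j\le T).$$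 **Theorem (Discrete infinitesimally extremal).** There is a constant $c>0$, depending only on the punctures, such that for every $0<\delta<1$, every $\varepsilon\le c\,\delta^{6n-2}$, every canonical triangulation $\Delta_\varepsilon$ (for $c$ and $\delta$) and every $\mu$ that is piecewise constant on $\Delta_\varepsilon$ with $\|\mu\|<1$: the program is convex (its quadratic forms are positive semidefinite) and has an optimal solution; $\nu=\mathcal P(\mu)$ exists and is unique; and every $\hat\nu$ returned by INEXT is infinitesimally equivalent to $\mu$ and satisfies $$\|\hat\nu\|-\|\nu\|<\delta\,\|\nu\|\quad\text{if }\nu\ne0,\qquad \hat\nu=0\quad\text{if }\nu=0.$$ -/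

import Mathlib

open MeasureTheory

noncomputable section

namespace Inext

/-! ### Punctured sphere, quadratic differentials, Beltrami differentials -/

/-- The finite punctures `0, 1, z₁, …, z_m` of the sphere; the point `∞` is also a puncture, so the
punctured sphere `R` is the plane minus this set, with a single global chart. -/
def punctures {m : ℕ} (z : Fin m → ℂ) : Set ℂ := {0, 1} ∪ Set.range z

/-- `A(R)`: integrable holomorphic quadratic differentials `φ(w) dw²` on the punctured sphere. -/
def QuadDiff {m : ℕ} (z : Fin m → ℂ) : Set (ℂ → ℂ) :=
  {φ | DifferentiableOn ℂ φ (punctures z)ᶜ ∧ Integrable φ}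

/-- The normalizing constant `η_k`. -/
def eta {m : ℕ} (z : Fin m → ℂ) (k : Fin m) : ℝ :=
  (∫ w : ℂ, ‖1 / (w * (w - 1) * (w - z k))‖)⁻¹

/-- The differentials `φ_k(w) = η_k / (w (w - 1) (w - z_k))`, of norm `1`. -/
def phi {m : ℕ} (z : Fin m → ℂ) (k : Fin m) (w : ℂ) : ℂ :=
  (eta z k : ℂ) / (w * (w - 1) * (w - z k))

/-- `B(R)`: Beltrami differentials, i.e. `L^∞` functions (the punctures have measure zero), with
the `L^∞` norm. -/
abbrev Beltrami : Type := Lp ℂ ⊤ (volume : Measure ℂ)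

/-- Infinitesimal equivalence of Beltrami differentials. -/
def InfEquiv {m : ℕ} (z : Fin m → ℂ) (μ ν : Beltrami) : Prop :=
  ∀ φ ∈ QuadDiff z, ∫ w, ‖φ w‖ = 1 → ∫ w, μ w * φ w = ∫ w, ν w * φ w

/-- `ν = P(μ)`: `ν` has least norm in the infinitesimal equivalence class of `μ`. -/
def IsInfExtremal {m : ℕ} (z : Fin m → ℂ) (μ ν : Beltrami) : Prop :=
  InfEquiv z ν μ ∧ ∀ β : Beltrami, InfEquiv z β μ → ‖ν‖ ≤ ‖β‖

/-! ### Triangulations of the sphere -/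

/-- The closed cell in `ℂ` spanned by a set `S` of points of the sphere: the convex hull `K` of the
finite points of `S` if `∞ ∉ S`, and `{t p | p ∈ K, t ≥ 1}` if `∞ ∈ S`.
So `{v, ∞}` spans the radial ray from `v` to `∞`. -/
def cell (S : Set (OnePoint ℂ)) : Set ℂ :=
  {x | ∃ p ∈ convexHull ℝ {v : ℂ | (v : OnePoint ℂ) ∈ S},
    ∃ t : ℝ, 1 ≤ t ∧ (OnePoint.infty ∉ S → t = 1) ∧ x = t • p}

/-- A finite triangulation of the sphere with straight edges, the edges to `∞` being radial rays.
A face is given by its three vertices. -/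
structure Triangulation where
  faces : Finset (Finset (OnePoint ℂ))
  card_face : ∀ s ∈ faces, s.card = 3
  nondegenerate : ∀ s ∈ faces, (interior (cell (s : Set (OnePoint ℂ)))).Nonempty
  cover : ∀ w : ℂ, ∃ s ∈ faces, w ∈ cell (s : Set (OnePoint ℂ))
  face_to_face : ∀ s ∈ faces, ∀ t ∈ faces,
    cell (s : Set (OnePoint ℂ)) ∩ cell (t : Set (OnePoint ℂ)) =
      cell ((s : Set (OnePoint ℂ)) ∩ (t : Set (OnePoint ℂ)))

namespace Triangulation

/-- The index type of the faces. -/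
abbrev Face (Δ : Triangulation) : Type := {s : Finset (OnePoint ℂ) // s ∈ Δ.faces}

/-- The closed region of `ℂ` covered by a face. -/
def region (Δ : Triangulation) (s : Δ.Face) : Set ℂ := cell (s.1 : Set (OnePoint ℂ))

/-- The set of vertices. -/
def vertices (Δ : Triangulation) : Set (OnePoint ℂ) := {v | ∃ s ∈ Δ.faces, v ∈ s}

/-- The union of all edges, as a subset of `ℂ`. -/
def skeleton (Δ : Triangulation) : Set ℂ :=
  {x | ∃ s ∈ Δ.faces, ∃ e : Finset (OnePoint ℂ), e ⊆ s ∧ e.card = 2 ∧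
    x ∈ cell (e : Set (OnePoint ℂ))}

/-- All edges, except those to `∞`, have length at most `ε`. -/
def MeshLE (Δ : Triangulation) (ε : ℝ) : Prop :=
  ∀ s ∈ Δ.faces, ∀ a b : ℂ, (a : OnePoint ℂ) ∈ s → (b : OnePoint ℂ) ∈ s → dist a b ≤ ε

/-- `Δ` is a refinement of `Δ₀`. -/
def Refines (Δ Δ₀ : Triangulation) : Prop :=
  ∀ s : Δ.Face, ∃ t : Δ₀.Face, Δ.region s ⊆ Δ₀.region t

end Triangulation

/-- The `j`-th vertex of the regular `N`-gon with center `p`, circumradius `r` and phase `θ`. -/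
def polyVertex (p : ℂ) (N : ℕ) (r θ : ℝ) (j : ℕ) : ℂ :=
  p + (r : ℂ) * Complex.exp (((θ + 2 * Real.pi * j / N : ℝ) : ℂ) * Complex.I)

namespace Triangulation

/-- `Δ` contains the vertices and edges of a regular `N`-gon with center `p`, circumradius `r` and
phase `θ`. An edge of the polygon may be a union of several edges of `Δ`. -/
def ContainsPolygon (Δ : Triangulation) (p : ℂ) (N : ℕ) (r θ : ℝ) : Prop :=
  3 ≤ N ∧ 0 < r ∧ ∀ j : ℕ, (polyVertex p N r θ j : OnePoint ℂ) ∈ Δ.vertices ∧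
    segment ℝ (polyVertex p N r θ j) (polyVertex p N r θ (j + 1)) ⊆ Δ.skeleton

/-- `Δ` contains a regular `N`-gon centered at `0` and the rays from its vertices to `∞`. -/
def ContainsOuterPolygon (Δ : Triangulation) (N : ℕ) (r : ℝ) : Prop :=
  ∃ θ : ℝ, Δ.ContainsPolygon 0 N r θ ∧
    ∀ (j : ℕ) (t : ℝ), 1 ≤ t → t • polyVertex 0 N r θ j ∈ Δ.skeleton

/-- `Δ` contains a regular `N`-gon centered at `p` and the segments from its vertices to `p`. -/
def ContainsSpokedPolygon (Δ : Triangulation) (p : ℂ) (N : ℕ) (r : ℝ) : Prop :=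
  ∃ θ : ℝ, Δ.ContainsPolygon p N r θ ∧
    ∀ j : ℕ, segment ℝ p (polyVertex p N r θ j) ⊆ Δ.skeleton

/-- A triangulation adapted to the punctures: all punctures are vertices, finite edges have length
at most `ε`, there is an outer regular polygon of circumdiameter at least `D`, and around each
finite puncture a spoked regular polygon with at least `N₀` sides and circumdiameter at most `d`. -/
def IsAdapted {m : ℕ} (z : Fin m → ℂ) (ε D d N₀ : ℝ) (Δ : Triangulation) : Prop :=
  OnePoint.infty ∈ Δ.vertices ∧ (∀ p ∈ punctures z, (p : OnePoint ℂ) ∈ Δ.vertices) ∧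
  Δ.MeshLE ε ∧
  (∃ (N : ℕ) (r : ℝ), D ≤ 2 * r ∧ Δ.ContainsOuterPolygon N r) ∧
  (∀ p ∈ punctures z, ∃ (N : ℕ) (r : ℝ), N₀ ≤ N ∧ 2 * r ≤ d ∧ Δ.ContainsSpokedPolygon p N r)

/-- Canonical triangulation of size `ε` for the tolerance `δ` and `n` punctures (`0`, `1`, `∞` and
`z₁, …, z_{n-3}`); `c` is the constant in the bounds of orders `δ⁻¹`, `δ` and `δ^(1-2n)`.
The last clause says that it refines such a triangulation of size `1/2`. -/
def IsCanonical (n : ℕ) (z : Fin (n - 3) → ℂ) (c δ ε : ℝ) (Δ : Triangulation) : Prop :=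
  Δ.IsAdapted z ε (1 / (c * δ)) (c * δ) (1 / (c * δ ^ (2 * n - 1))) ∧
  ∃ (Δ₀ : Triangulation) (d : ℝ), Δ₀.IsAdapted z (1 / 2) 0 d 0 ∧ Δ.Refines Δ₀

end Triangulation

/-! ### Piecewise constant Beltrami differentials -/

lemma measurableSet_cell (s : Finset (OnePoint ℂ)) :
    MeasurableSet (cell (s : Set (OnePoint ℂ))) := by
  have hfin : {v : ℂ | (v : OnePoint ℂ) ∈ (s : Set (OnePoint ℂ))}.Finite :=
    s.finite_toSet.preimage (OnePoint.coe_injective.injOn)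
  have hK : IsCompact (convexHull ℝ {v : ℂ | (v : OnePoint ℂ) ∈ (s : Set (OnePoint ℂ))}) :=
    hfin.isCompact_convexHull ℝ
  set K := convexHull ℝ {v : ℂ | (v : OnePoint ℂ) ∈ (s : Set (OnePoint ℂ))} with hKdef
  set T : Set ℝ := {t | 1 ≤ t ∧ (OnePoint.infty ∉ (s : Set (OnePoint ℂ)) → t = 1)} with hT
  have hTc : IsClosed T := by
    by_cases h : OnePoint.infty ∈ (s : Set (OnePoint ℂ))
    · have : T = Set.Ici 1 := by ext t; simp [hT, h]
      rw [this]; exact isClosed_Ici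
    · have : T = {1} := by
        ext t
        simp only [hT, Set.mem_ofPred_eq, Set.mem_singleton_iff]
        exact ⟨fun ht => ht.2 h, fun ht => ⟨ht.ge, fun _ => ht⟩⟩
      rw [this]; exact isClosed_singleton
  have hEq : cell (s : Set (OnePoint ℂ)) =
      ⋃ k : ℕ, (fun q : ℝ × ℂ => q.1 • q.2) '' ((T ∩ Set.Icc 0 (k : ℝ)) ×ˢ K) := by
    ext x
    simp only [cell, Set.mem_ofPred_eq, Set.mem_iUnion, Set.mem_image, Set.mem_prod, Prod.exists]
    constructor
    · rintro ⟨p, hp, t, h1, h2, rfl⟩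
      obtain ⟨k, hk⟩ := exists_nat_ge t
      exact ⟨k, t, p, ⟨⟨⟨h1, h2⟩, by linarith, hk⟩, hp⟩, rfl⟩
    · rintro ⟨k, t, p, ⟨⟨⟨h1, h2⟩, -⟩, hp⟩, rfl⟩
      exact ⟨p, hp, t, h1, h2, rfl⟩
  rw [hEq]
  refine MeasurableSet.iUnion fun k => ?_
  refine IsCompact.measurableSet (IsCompact.image ?_ (by fun_prop))
  exact (isCompact_Icc.inter_left hTc).prod hK

namespace Triangulation

/-- The function equal to `a s` on the face `s` (away from the edges, a null set). -/
def pwFun (Δ : Triangulation) (a : Δ.Face → ℂ) (w : ℂ) : ℂ :=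
  ∑ s : Δ.Face, (Δ.region s).indicator (fun _ => a s) w

lemma memLp_pwFun (Δ : Triangulation) (a : Δ.Face → ℂ) :
    MemLp (Δ.pwFun a) ⊤ (volume : Measure ℂ) := by
  unfold pwFun
  exact memLp_finsetSum _ fun s _ => (memLp_top_const (a s)).indicator (measurableSet_cell s.1)

/-- The piecewise constant Beltrami differential on `Δ` with values `a`. -/
def pwConst (Δ : Triangulation) (a : Δ.Face → ℂ) : Beltrami := (Δ.memLp_pwFun a).toLp

end Triangulation

/-! ### Quadratically constrained quadratic programs and INEXT -/

/-- Minimize `βᵗ Q β + q · β` subject to `E β = e` and `βᵗ P_j β + p_j · β ≤ r_j` for all `j`. -/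
structure QCQP (ι κ τ : Type*) where
  Q : Matrix ι ι ℝ
  q : ι → ℝ
  E : Matrix κ ι ℝ
  e : κ → ℝ
  P : τ → Matrix ι ι ℝ
  p : τ → ι → ℝ
  r : τ → ℝ

namespace QCQP

variable {ι κ τ : Type*} [Fintype ι]

def objective (prog : QCQP ι κ τ) (β : ι → ℝ) : ℝ :=
  β ⬝ᵥ (prog.Q.mulVec β) + prog.q ⬝ᵥ β

def Feasible (prog : QCQP ι κ τ) (β : ι → ℝ) : Prop :=
  prog.E.mulVec β = prog.e ∧ ∀ j, β ⬝ᵥ ((prog.P j).mulVec β) + prog.p j ⬝ᵥ β ≤ prog.r j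

def IsOptimal (prog : QCQP ι κ τ) (β : ι → ℝ) : Prop :=
  prog.Feasible β ∧ ∀ β', prog.Feasible β' → prog.objective β ≤ prog.objective β'

/-- All the quadratic forms of the program are positive semidefinite. -/
def IsConvex (prog : QCQP ι κ τ) : Prop :=
  prog.Q.PosSemidef ∧ ∀ j, (prog.P j).PosSemidef

end QCQP

/-- The unknowns `(λ_r, λ_i, ζ)` of the discrete program. -/
abbrev Var (Δ : Triangulation) : Type := Δ.Face ⊕ Δ.Face ⊕ Unit

/-- The matrix `A`, with entries `∫_{t_j} φ_i`. -/
def constraintMatrix {m : ℕ} (z : Fin m → ℂ) (Δ : Triangulation) : Matrix (Fin m) Δ.Face ℂ :=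
  Matrix.of fun i s => ∫ w in Δ.region s, phi z i w

open Classical in
/-- The discrete program for a piecewise constant `μ` with values `a`: with `A = A_r + i A_i` and
`b = A a = b_r + i b_i`, minimize `ζ` subject to `A_r λ_r - A_i λ_i = b_r`,
`A_i λ_r + A_r λ_i = b_i` and `λ_{r,s}² + λ_{i,s}² - ζ ≤ 0` for each face `s`. -/
def discreteProgram {m : ℕ} (z : Fin m → ℂ) (Δ : Triangulation) (a : Δ.Face → ℂ) :
    QCQP (Var Δ) (Fin m ⊕ Fin m) Δ.Face where
  Q := 0
  q := Sum.elim 0 (Sum.elim 0 1)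
  E := Matrix.of (Sum.elim
    (fun i => Sum.elim (fun s => (constraintMatrix z Δ i s).re)
      (Sum.elim (fun s => -(constraintMatrix z Δ i s).im) 0))
    (fun i => Sum.elim (fun s => (constraintMatrix z Δ i s).im)
      (Sum.elim (fun s => (constraintMatrix z Δ i s).re) 0)))
  e := Sum.elim (fun i => ((constraintMatrix z Δ).mulVec a i).re)
    (fun i => ((constraintMatrix z Δ).mulVec a i).im)
  P := fun s => Matrix.diagonal
    (Sum.elim (Pi.single s 1) (Sum.elim (Pi.single s 1) 0))
  p := fun _ => Sum.elim 0 (Sum.elim 0 (-1))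
  r := 0

/-- `v` is returned by INEXT on the input `(z, Δ, a)`: INEXT assembles the discrete program, solves
it to optimality, and returns the complex values `λ = λ_r + i λ_i` of an optimal solution. -/
def InextReturns {m : ℕ} (z : Fin m → ℂ) (Δ : Triangulation) (a v : Δ.Face → ℂ) : Prop :=
  ∃ β : Var Δ → ℝ, (discreteProgram z Δ a).IsOptimal β ∧
    ∀ s, v s = ⟨β (Sum.inl s), β (Sum.inr (Sum.inl s))⟩

end Inext

end

/-! ### Plane geometry of the faces: null overlaps and the position of the unbounded faces. -/

namespace Inext

/-! ### Geometry of the cells -/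

/-! Integrability and the area mean value inequality force (w - p)²φ → 0 at every finite p and w²φ →
0 at ∞ for φ in A(R). Subtracting the combination of the φ_k with the same residues at the z_k and
applying Liouville leaves zero, so the φ_k span A(R) (`QuadDiff.exists_eq_sum_phi`). Infinitesimal
equivalence thus amounts to finitely many complex linear equations (`infEquiv_iff`), and both
extremal problems are dual to norms on this span.

For P(μ) the dual norm is ∫|φ|. If μ does not annihilate the span, a minimizer f of this norm on the
hyperplane ∫μφ = 1 gives the extremal differential conj f / (‖f‖ |f|), and the equality case of the
pairing inequality gives uniqueness (`existsUnique_isInfExtremal`). For INEXT the dual norm is the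
smaller Σ|∫_t φ| over the faces t; Hahn–Banach turns a bound for it into face values
(`exists_mulVec_eq_of_dual_bound`). Hence ∫|φ| ≤ C Σ|∫_t φ| on the span implies ‖ν̂‖ ≤ C‖ν‖
(`norm_pwConst_le_of_inextReturns`).

Such an inequality, with C = 1 + δ/2, says that little cancels inside a face. The error for φ_k is
O(ε/ρ) from oscillation on bounded faces at distance ρ from the poles, O(ρ) from the mass near the
poles, and O(1/R) from the unbounded faces, which the outer polygon keeps outside the disk of radius
R (`Triangulation.half_radius_le_norm`). Equivalence of norms on the span extends this to
combinations (`exists_norm_le_add_sum_norm_setIntegral`). Taking ρ of order δ, with ε = O(δ²) and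
1/R = O(δ), makes the total error a small multiple of δ. -/

lemma cell_mono {S T : Set (OnePoint ℂ)} (h : S ⊆ T) : cell S ⊆ cell T := by
  rintro x ⟨p, hp, t, h1, h2, rfl⟩
  exact ⟨p, convexHull_mono
    (show {v : ℂ | (v : OnePoint ℂ) ∈ S} ⊆ {v : ℂ | (v : OnePoint ℂ) ∈ T} from fun v hv => h hv) hp,
    t, h1, fun hT => h2 fun hS => hT (h hS), rfl⟩

lemma mem_cell_insert_infty {S : Set (OnePoint ℂ)} {x : ℂ} :
    x ∈ cell (insert OnePoint.infty S) ↔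
      ∃ p ∈ convexHull ℝ {v : ℂ | (v : OnePoint ℂ) ∈ S}, ∃ t : ℝ, 1 ≤ t ∧ x = t • p := by
  simp [cell]

lemma mem_cell_pair {a b x : ℂ} :
    x ∈ cell {(a : OnePoint ℂ), (b : OnePoint ℂ)} ↔ x ∈ segment ℝ a b := by
  have : {v : ℂ | (v : OnePoint ℂ) ∈ ({(a : OnePoint ℂ), (b : OnePoint ℂ)} : Set _)} = {a, b} := by
    ext v; simp
  simp only [cell, this, convexHull_pair]
  constructor
  · rintro ⟨p, hp, t, -, h2, rfl⟩
    rw [h2 (by simp), one_smul]; exact hp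
  · intro hx
    exact ⟨x, hx, 1, le_rfl, fun _ => rfl, (one_smul _ _).symm⟩

/-- Two vertices span a segment or a radial ray, fewer span a point or nothing. This makes overlaps
of distinct faces null. -/
lemma cell_subset_line (e : Finset (OnePoint ℂ)) (he : e.card ≤ 2) :
    ∃ p q : ℂ, cell (e : Set (OnePoint ℂ)) ⊆ {x | ∃ t : ℝ, x = p + t • q} := by
  classical
  rcases Set.eq_empty_or_nonempty {v : ℂ | (v : OnePoint ℂ) ∈ (e : Set (OnePoint ℂ))} with h | ⟨a, ha⟩
  · refine ⟨0, 0, ?_⟩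
    rintro x ⟨p, hp, -⟩
    rw [h, convexHull_empty] at hp
    exact hp.elim
  have ha' : (a : OnePoint ℂ) ∈ e := ha
  have hcard : (e.erase (a : OnePoint ℂ)).card ≤ 1 := by
    rw [Finset.card_erase_of_mem ha']; omega
  rw [Finset.card_le_one] at hcard
  by_cases hi : OnePoint.infty ∈ e
  · refine ⟨0, a, ?_⟩
    have hsub : (e : Set (OnePoint ℂ)) ⊆ insert OnePoint.infty {(a : OnePoint ℂ)} := by
      intro v hv
      by_cases hva : v = (a : OnePoint ℂ)
      · simp [hva]
      · left
        exact hcard v (by simp [hva]; exact hv) _ (by simp [hi])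
    intro x hx
    obtain ⟨p, hp, t, -, rfl⟩ := mem_cell_insert_infty.1 (cell_mono hsub hx)
    have : {v : ℂ | (v : OnePoint ℂ) ∈ ({(a : OnePoint ℂ)} : Set _)} = {a} := by ext; simp
    rw [this, convexHull_singleton] at hp
    exact ⟨t, by rw [Set.mem_singleton_iff.1 hp, zero_add]⟩
  · obtain ⟨b, hb⟩ : ∃ b : ℂ, (e : Set (OnePoint ℂ)) ⊆ {(a : OnePoint ℂ), (b : OnePoint ℂ)} := by
      by_cases hne : ∃ v ∈ e, v ≠ (a : OnePoint ℂ)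
      · obtain ⟨v, hv, hva⟩ := hne
        obtain ⟨b, rfl⟩ : ∃ b : ℂ, (b : OnePoint ℂ) = v :=
          OnePoint.ne_infty_iff_exists.1 fun h => hi (h ▸ hv)
        refine ⟨b, fun w hw => ?_⟩
        by_cases hwa : w = (a : OnePoint ℂ)
        · simp [hwa]
        · right
          exact hcard w (by simp [hwa]; exact hw) _ (by simp [hv]; simpa using hva)
      · push Not at hne
        exact ⟨a, fun w hw => by simp [hne w hw]⟩
    refine ⟨a, b - a, fun x hx => ?_⟩
    have := mem_cell_pair.1 (cell_mono hb hx)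
    rw [segment_eq_image'] at this
    obtain ⟨t, -, rfl⟩ := this
    exact ⟨t, rfl⟩

lemma volume_line (p q : ℂ) : volume {x : ℂ | ∃ t : ℝ, x = p + t • q} = 0 := by
  have hsub : {x : ℂ | ∃ t : ℝ, x = p + t • q} ⊆ (AffineSubspace.mk' p (Submodule.span ℝ {q})) := by
    rintro x ⟨t, rfl⟩
    rw [SetLike.mem_coe, AffineSubspace.mem_mk']
    simp only [vsub_eq_sub, add_sub_cancel_left]
    exact Submodule.smul_mem _ _ (Submodule.mem_span_singleton_self q)
  refine measure_mono_null hsub (Measure.addHaar_affineSubspace _ _ fun htop => ?_)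
  have h1 : Submodule.span ℝ {q} = ⊤ := by
    rw [← AffineSubspace.direction_mk' p (Submodule.span ℝ {q}), htop, AffineSubspace.direction_top]
  have h2 := finrank_span_le_card (R := ℝ) ({q} : Set ℂ)
  rw [h1, finrank_top, Complex.finrank_real_complex] at h2
  simp at h2

lemma volume_cell_eq_zero (e : Finset (OnePoint ℂ)) (he : e.card ≤ 2) :
    volume (cell (e : Set (OnePoint ℂ))) = 0 := by
  obtain ⟨p, q, h⟩ := cell_subset_line e he
  exact measure_mono_null h (volume_line p q)

namespace Triangulation

variable (Δ : Triangulation)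

lemma card_inter_le_two {s t : Finset (OnePoint ℂ)} [DecidableEq (OnePoint ℂ)]
    (hs : s ∈ Δ.faces) (ht : t ∈ Δ.faces) (hst : s ≠ t) : (s ∩ t).card ≤ 2 := by
  have h1 := Δ.card_face s hs
  have h2 := Δ.card_face t ht
  by_contra! hlt
  have hs' : s ∩ t = s := Finset.eq_of_subset_of_card_le Finset.inter_subset_left (by omega)
  have ht' : s ∩ t = t := Finset.eq_of_subset_of_card_le Finset.inter_subset_right (by omega)
  exact hst (hs'.symm.trans ht')

/-- Almost every point of the plane lies in exactly one face. -/
lemma ae_existsUnique_face : ∀ᵐ w : ℂ, ∃! s : Δ.Face, w ∈ Δ.region s := by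
  classical
  have h : ∀ᵐ w : ℂ, ∀ s t : Δ.Face, s ≠ t → w ∉ Δ.region s ∩ Δ.region t := by
    rw [ae_all_iff]; intro s
    rw [ae_all_iff]; intro t
    by_cases hst : s = t
    · simp [hst]
    · have h0 : volume (Δ.region s ∩ Δ.region t) = 0 := by
        have := Δ.face_to_face s.1 s.2 t.1 t.2
        unfold region
        rw [this, ← Finset.coe_inter]
        exact volume_cell_eq_zero _
          (Δ.card_inter_le_two s.2 t.2 fun h => hst (Subtype.ext h))
      filter_upwards [measure_eq_zero_iff_ae_notMem.1 h0] with w hw _ using hw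
  filter_upwards [h] with w hw
  obtain ⟨s, hs, hws⟩ := Δ.cover w
  refine ⟨⟨s, hs⟩, hws, fun t ht => ?_⟩
  by_contra hne
  exact hw t ⟨s, hs⟩ hne ⟨ht, hws⟩

instance instNonemptyFace : Nonempty Δ.Face := by
  obtain ⟨s, hs, -⟩ := Δ.cover 0
  exact ⟨⟨s, hs⟩⟩

/-- A point of a face that lies on the skeleton lies on a proper subface. -/
lemma exists_proper_subface {s : Finset (OnePoint ℂ)} (hs : s ∈ Δ.faces) {x : ℂ}
    (hx : x ∈ cell (s : Set (OnePoint ℂ))) (hsk : x ∈ Δ.skeleton) :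
    ∃ v ∈ s, x ∈ cell ((s : Set (OnePoint ℂ)) \ {v}) := by
  classical
  suffices h : ∃ f ⊆ s, f.card ≤ 2 ∧ x ∈ cell (f : Set (OnePoint ℂ)) by
    obtain ⟨f, hfs, hf, hxf⟩ := h
    obtain ⟨v, hv, hvf⟩ : ∃ v ∈ s, v ∉ f := by
      by_contra! hcon
      have := Finset.card_le_card (show s ⊆ f from hcon)
      rw [Δ.card_face s hs] at this
      omega
    refine ⟨v, hv, cell_mono (fun w hw => Set.mem_sdiff_singleton.2 ⟨hfs hw, ?_⟩) hxf⟩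
    rintro rfl
    exact hvf hw
  obtain ⟨t, ht, e, het, he, hxe⟩ := hsk
  by_cases hst : s = t
  · subst hst
    exact ⟨e, het, he.le, hxe⟩
  -- The edge belongs to another face, and two faces meet exactly in the cell of their common
  -- vertices.
  · refine ⟨s ∩ t, Finset.inter_subset_left, Δ.card_inter_le_two hs ht hst, ?_⟩
    rw [Finset.coe_inter, ← Δ.face_to_face s hs t ht]
    exact ⟨hx, cell_mono (Finset.coe_subset.2 het) hxe⟩

end Triangulation

/-! ### Regular polygons -/

/-- A ray from the origin that starts inside the inscribed disk crosses the regular polygon. -/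
lemma exists_ray_crossing {N : ℕ} (hN : 3 ≤ N) {r : ℝ} (hr : 0 < r) (θ : ℝ) {p : ℂ}
    (hp : p ≠ 0) (hpr : ‖p‖ < r / 2) :
    ∃ (j : ℕ) (t : ℝ), 1 < t ∧
      t • p ∈ segment ℝ (polyVertex 0 N r θ j) (polyVertex 0 N r θ (j + 1)) := by
  have hN0 : (0 : ℝ) < N := by positivity
  have hπ := Real.pi_pos
  -- The argument of p is lifted above the phase θ so that the index of the sector containing p is a
  -- natural number.
  obtain ⟨α, hα, hpα⟩ : ∃ α : ℝ, θ ≤ α ∧ p = ‖p‖ * Complex.exp (α * Complex.I) := by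
    obtain ⟨k, hk⟩ := exists_nat_ge ((θ - p.arg) / (2 * Real.pi))
    refine ⟨p.arg + k * (2 * Real.pi), ?_, ?_⟩
    · rw [div_le_iff₀ (by positivity)] at hk; linarith
    · have : ((p.arg + k * (2 * Real.pi) : ℝ) : ℂ) * Complex.I
          = p.arg * Complex.I + k * (2 * Real.pi * Complex.I) := by push_cast; ring
      rw [this, Complex.exp_periodic.nat_mul k, Complex.norm_mul_exp_arg_mul_I]
  set h := 2 * Real.pi / N with hh
  have hh0 : 0 < h := by positivity
  have hhπ : h ≤ 2 * Real.pi / 3 := by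
    rw [hh]; gcongr; exact_mod_cast hN
  set j := ⌊(α - θ) / h⌋₊ with hj
  have hj1 : (j : ℝ) * h ≤ α - θ := by
    rw [← le_div_iff₀ hh0]; exact Nat.floor_le (div_nonneg (by linarith) hh0.le)
  have hj2 : α - θ < ((j : ℝ) + 1) * h := by
    rw [← div_lt_iff₀ hh0]; exact Nat.lt_floor_add_one _
  set x := α - (θ + j * h) with hx
  set y := θ + (j + 1) * h - α with hy
  have hx0 : 0 ≤ x := by rw [hx]; linarith
  have hy0 : 0 < y := by rw [hy]; linarith
  have hxy : x + y = h := by rw [hx, hy]; ring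
  have hsh : 0 < Real.sin h := Real.sin_pos_of_pos_of_lt_pi hh0 (by linarith)
  have hsx : 0 ≤ Real.sin x := Real.sin_nonneg_of_nonneg_of_le_pi hx0 (by linarith)
  have hsy : 0 < Real.sin y := Real.sin_pos_of_pos_of_lt_pi hy0 (by linarith)
  have hv1 : polyVertex 0 N r θ j = r * (Complex.exp (α * Complex.I) *
      Complex.exp (-x * Complex.I)) := by
    rw [← Complex.exp_add, polyVertex, zero_add]
    congr 2
    rw [hx, hh]; push_cast; ring
  have hv2 : polyVertex 0 N r θ (j + 1) = r * (Complex.exp (α * Complex.I) *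
      Complex.exp (y * Complex.I)) := by
    rw [← Complex.exp_add, polyVertex, zero_add]
    congr 2
    rw [hy, hh]; push_cast; ring
  have hp0 : 0 < ‖p‖ := norm_pos_iff.2 hp
  -- Here x and y are the angles from p to the two neighbouring vertices. The identity writes the
  -- direction of p as a combination of the vertex directions, so normalizing sin y and sin x gives
  -- the weights of the crossing point.
  have key : (Real.sin y : ℂ) * Complex.exp (-x * Complex.I) +
      Real.sin x * Complex.exp (y * Complex.I) = Real.sin h := by
    rw [← hxy, Real.sin_add, ← Complex.ofReal_neg, Complex.exp_mul_I, Complex.exp_mul_I,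
      ← Complex.ofReal_cos, ← Complex.ofReal_sin, ← Complex.ofReal_cos, ← Complex.ofReal_sin,
      Real.cos_neg, Real.sin_neg]
    push_cast; ring
  have hS : 0 < Real.sin y + Real.sin x := by linarith
  -- This says that the inradius is at least half the circumradius: N ≥ 3 gives h/2 ≤ π/3, hence cos
  -- (h/2) ≥ 1/2.
  have hSh : Real.sin y + Real.sin x ≤ 2 * Real.sin h := by
    have e1 : Real.sin y + Real.sin x = 2 * Real.sin (h / 2) * Real.cos ((y - x) / 2) := by
      rw [← hxy, show y = (x + y) / 2 + (y - x) / 2 by ring,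
        show x = (x + y) / 2 - (y - x) / 2 by ring]
      rw [Real.sin_add, Real.sin_sub]; ring_nf
    have e2 : Real.sin h = 2 * Real.sin (h / 2) * Real.cos (h / 2) := by
      rw [← Real.sin_two_mul]; ring_nf
    have e3 : 0 ≤ Real.sin (h / 2) := Real.sin_nonneg_of_nonneg_of_le_pi (by linarith) (by linarith)
    have e4 : 1 / 2 ≤ Real.cos (h / 2) := by
      rw [← Real.cos_pi_div_three]
      exact Real.cos_le_cos_of_nonneg_of_le_pi (by linarith) (by linarith) (by linarith)
    have e5 := Real.cos_le_one ((y - x) / 2)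
    rw [e1, e2]
    nlinarith
  refine ⟨j, r * Real.sin h / (‖p‖ * (Real.sin y + Real.sin x)), ?_, ?_⟩
  · rw [one_lt_div (by positivity)]
    nlinarith
  · refine ⟨Real.sin y / (Real.sin y + Real.sin x), Real.sin x / (Real.sin y + Real.sin x),
      by positivity, by positivity, by field_simp, ?_⟩
    rw [hv1, hv2]
    simp only [Complex.real_smul]
    have hpe : ∀ τ : ℂ, τ * p = τ * (‖p‖ * Complex.exp (α * Complex.I)) :=
      fun τ => by rw [← hpα]
    refine Eq.trans ?_ (hpe _).symm
    have hS' : ((Real.sin y : ℂ) + Real.sin x) ≠ 0 := by exact_mod_cast hS.ne'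
    have hp' : (‖p‖ : ℂ) ≠ 0 := by exact_mod_cast hp0.ne'
    push_cast at key hS' ⊢
    generalize Complex.exp (-x * Complex.I) = E₁ at key ⊢
    generalize Complex.exp (y * Complex.I) = E₂ at key ⊢
    field_simp
    linear_combination (r : ℂ) * key

namespace Triangulation

/-- The unbounded faces lie outside the disk of half the circumradius of the outer polygon. -/
lemma half_radius_le_norm (Δ : Triangulation) {N : ℕ} {r : ℝ} (h : Δ.ContainsOuterPolygon N r)
    {s : Finset (OnePoint ℂ)} (hs : s ∈ Δ.faces) (hi : OnePoint.infty ∈ s) {w : ℂ}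
    (hw : w ∈ cell (s : Set (OnePoint ℂ))) : r / 2 ≤ ‖w‖ := by
  classical
  obtain ⟨θ, ⟨hN, hr, hpoly⟩, -⟩ := h
  obtain ⟨a, b, hsab⟩ : ∃ a b : ℂ, (s : Set (OnePoint ℂ)) =
      insert OnePoint.infty {(a : OnePoint ℂ), (b : OnePoint ℂ)} := by
    have hc : (s.erase OnePoint.infty).card = 2 := by
      rw [Finset.card_erase_of_mem hi, Δ.card_face s hs]
    obtain ⟨a, b, -, hab⟩ := Finset.card_eq_two.1 hc
    have hA : a ∈ s.erase OnePoint.infty := by simp [hab]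
    have hB : b ∈ s.erase OnePoint.infty := by simp [hab]
    obtain ⟨a, rfl⟩ := OnePoint.ne_infty_iff_exists.1 (Finset.ne_of_mem_erase hA)
    obtain ⟨b, rfl⟩ := OnePoint.ne_infty_iff_exists.1 (Finset.ne_of_mem_erase hB)
    refine ⟨a, b, ?_⟩
    rw [← Finset.insert_erase hi, hab]
    simp
  have hset : {v : ℂ | (v : OnePoint ℂ) ∈ ({(a : OnePoint ℂ), (b : OnePoint ℂ)} : Set _)}
      = {a, b} := by ext v; simp
  have hmem : ∀ x : ℂ, x ∈ cell (s : Set (OnePoint ℂ)) ↔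
      ∃ p ∈ segment ℝ a b, ∃ t : ℝ, 1 ≤ t ∧ x = t • p := by
    intro x
    rw [hsab, mem_cell_insert_infty, hset, convexHull_pair]
  -- If a and b were collinear with the origin, the face would lie on a line and have empty
  -- interior. So a and b are real coordinates on ℂ.
  have hnd : ¬ ∃ q : ℂ, ∃ α β : ℝ, a = α • q ∧ b = β • q := by
    rintro ⟨q, α, β, rfl, rfl⟩
    have hpos := (isOpen_interior.measure_pos volume (Δ.nondegenerate s hs)).trans_le
      (measure_mono interior_subset)
    refine hpos.ne' (measure_mono_null ?_ (volume_line 0 q))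
    intro x hx
    obtain ⟨p, ⟨u, v, -, -, -, rfl⟩, t, -, rfl⟩ := (hmem x).1 hx
    exact ⟨t * (u * α + v * β), by simp only [Complex.real_smul]; push_cast; ring⟩
  have hli : ∀ u v u' v' : ℝ, u • a + v • b = u' • a + v' • b → u = u' ∧ v = v' := by
    intro u v u' v' he
    by_contra hcon
    apply hnd
    by_cases hu : u = u'
    · have hv : v - v' ≠ 0 := fun h0 => hcon ⟨hu, by linarith⟩
      refine ⟨a, 1, 0, (one_smul _ _).symm, ?_⟩
      subst hu
      have : (v - v') • b = 0 := by
        rw [sub_smul, sub_eq_zero]; exact add_left_cancel he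
      rw [zero_smul]
      exact (smul_eq_zero.1 this).resolve_left hv
    · have hu' : u - u' ≠ 0 := sub_ne_zero.2 hu
      refine ⟨b, (v' - v) / (u - u'), 1, ?_, (one_smul _ _).symm⟩
      have : (u - u') • a = (v' - v) • b := by
        rw [sub_smul, sub_smul, sub_eq_sub_iff_add_eq_add, he]; abel
      rw [div_eq_inv_mul, mul_smul, ← this, smul_smul, inv_mul_cancel₀ hu', one_smul]
  -- The ray outward from such a p stays in the face. If p were in the disk, the ray would cross the
  -- polygon at t p with t > 1, a point of the skeleton and so of a proper subface. But its
  -- coordinates t u, t v are positive with sum t > 1: it is neither on a bounding ray (a coordinate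
  -- 0) nor on the segment from a to b (sum 1).
  have hopen : ∀ p ∈ openSegment ℝ a b, r / 2 ≤ ‖p‖ := by
    rintro p ⟨u, v, hu, hv, huv, rfl⟩
    by_contra! hlt
    have hp0 : u • a + v • b ≠ 0 := by
      intro h0
      have := (hli u v 0 0 (by simpa using h0)).1
      linarith
    obtain ⟨j, t, ht, hseg⟩ := exists_ray_crossing hN hr θ hp0 hlt
    have hsk := (hpoly j).2 hseg
    have htp : t • (u • a + v • b) = (t * u) • a + (t * v) • b := by
      rw [smul_add, smul_smul, smul_smul]
    obtain ⟨x, hx, hxc⟩ := Δ.exists_proper_subface hs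
      ((hmem _).2 ⟨_, ⟨u, v, hu.le, hv.le, huv, rfl⟩, t, ht.le, rfl⟩) hsk
    have hx' : x ∈ (s : Set (OnePoint ℂ)) := hx
    have hray : ∀ c : ℂ, ∀ y : ℂ, y ∈ cell (insert OnePoint.infty {(c : OnePoint ℂ)}) →
        ∃ t : ℝ, y = t • c := by
      intro c y hy
      obtain ⟨p, hp, t, -, rfl⟩ := mem_cell_insert_infty.1 hy
      have : {v : ℂ | (v : OnePoint ℂ) ∈ ({(c : OnePoint ℂ)} : Set _)} = {c} := by ext; simp
      rw [this, convexHull_singleton] at hp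
      exact ⟨t, by rw [Set.mem_singleton_iff.1 hp]⟩
    rw [hsab] at hx' hxc
    rcases hx' with rfl | rfl | rfl
    · obtain ⟨u', v', -, -, huv', he⟩ := mem_cell_pair.1 (cell_mono (by
        rintro y ⟨hy | hy, hy'⟩
        · exact absurd hy hy'
        · exact hy) hxc)
      rw [htp] at he
      obtain ⟨h1, h2⟩ := hli _ _ _ _ he
      rw [h1, h2, ← mul_add, huv, mul_one] at huv'
      linarith
    · obtain ⟨t', he⟩ := hray b _ (cell_mono (by
        rintro y ⟨hy | hy | hy, hy'⟩
        · left; exact hy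
        · exact absurd hy hy'
        · right; exact hy) hxc)
      rw [htp] at he
      obtain ⟨h1, -⟩ := hli (t * u) (t * v) 0 t' (by rw [he, zero_smul, zero_add])
      nlinarith
    · obtain ⟨t', he⟩ := hray a _ (cell_mono (by
        rintro y ⟨hy | hy | hy, hy'⟩
        · left; exact hy
        · right; exact hy
        · exact absurd hy hy') hxc)
      rw [htp] at he
      obtain ⟨-, h1⟩ := hli (t * u) (t * v) t' 0 (by rw [he, zero_smul, add_zero])
      nlinarith
  -- The endpoints lie on the bounding rays, where that argument gives no contradiction; they are
  -- reached by closure.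
  have hclosed : ∀ p ∈ segment ℝ a b, r / 2 ≤ ‖p‖ := by
    intro p hp
    rw [← closure_openSegment] at hp
    exact closure_minimal (t := {p : ℂ | r / 2 ≤ ‖p‖}) hopen
      (isClosed_le continuous_const continuous_norm) hp
  obtain ⟨p, hp, t, ht, rfl⟩ := (hmem w).1 hw
  rw [norm_smul, Real.norm_of_nonneg (by linarith)]
  have := hclosed p hp
  nlinarith [norm_nonneg p]

/-- Two points of a bounded face have distance at most the mesh size. -/
lemma dist_le_of_mem_cell (Δ : Triangulation) {ε : ℝ} (h : Δ.MeshLE ε)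
    {s : Finset (OnePoint ℂ)} (hs : s ∈ Δ.faces) (hi : OnePoint.infty ∉ s) {w w' : ℂ}
    (hw : w ∈ cell (s : Set (OnePoint ℂ))) (hw' : w' ∈ cell (s : Set (OnePoint ℂ))) :
    dist w w' ≤ ε := by
  obtain ⟨p, hp, t, -, ht, rfl⟩ := hw
  obtain ⟨p', hp', t', -, ht', rfl⟩ := hw'
  rw [ht hi, ht' hi, one_smul, one_smul]
  obtain ⟨a, ha, b, hb, hab⟩ := convexHull_exists_dist_ge2 hp hp'
  exact hab.trans (h s hs a b ha hb)

lemma volume_region_lt_top (Δ : Triangulation) (s : Δ.Face) (hi : OnePoint.infty ∉ s.1) :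
    volume (Δ.region s) < ⊤ := by
  refine Bornology.IsBounded.measure_lt_top ?_
  have hfin : {v : ℂ | (v : OnePoint ℂ) ∈ (s.1 : Set (OnePoint ℂ))}.Finite :=
    s.1.finite_toSet.preimage (OnePoint.coe_injective.injOn)
  refine (hfin.isCompact_convexHull ℝ).isBounded.subset ?_
  rintro x ⟨p, hp, t, -, ht, rfl⟩
  rw [ht hi, one_smul]; exact hp

lemma measurableSet_region (Δ : Triangulation) (s : Δ.Face) : MeasurableSet (Δ.region s) :=
  measurableSet_cell s.1

lemma region_nonempty (Δ : Triangulation) (s : Δ.Face) : (Δ.region s).Nonempty :=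
  (Δ.nondegenerate s.1 s.2).mono interior_subset

end Triangulation

end Inext

/-! ### Integrability and mass estimates for the rational differentials. -/

namespace Inext

/-! ### Radial integrals in the plane -/

/-- In polar coordinates the area factor r cancels the singularity; a translation and an enlarged
disk cover any center. -/
lemma integrableOn_inv_norm_sub (q c : ℂ) (ρ : ℝ) :
    IntegrableOn (fun w : ℂ => ‖w - q‖⁻¹) (Metric.ball c ρ) := by
  have h0 : ∀ R : ℝ, IntegrableOn (fun w : ℂ => ‖w‖⁻¹) (Metric.ball 0 R) := by
    intro R
    rw [integrableOn_fun_norm_addHaar volume (f := fun y : ℝ => y⁻¹)]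
    refine IntegrableOn.congr_fun (f := fun _ => (1 : ℝ)) (by simp) ?_ measurableSet_Ioo
    intro y hy
    have : y ≠ 0 := hy.1.ne'
    simp [Complex.finrank_real_complex, this]
  have h1 := (integrable_indicator_iff measurableSet_ball).2 (h0 (ρ + dist c q))
  have h2 := h1.comp_sub_right q
  refine IntegrableOn.mono_set ((integrable_indicator_iff
    (measurableSet_ball (x := q) (ε := ρ + dist c q))).1 (h2.congr ?_)) ?_
  · refine Filter.Eventually.of_forall fun w => ?_
    simp only [Set.indicator, Metric.mem_ball, dist_eq_norm, sub_zero]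
  · intro w hw
    rw [Metric.mem_ball] at hw ⊢
    linarith [dist_triangle w c q]

lemma setIntegral_ball_inv_norm {ρ : ℝ} (hρ : 0 < ρ) :
    ∫ w in Metric.ball (0 : ℂ) ρ, ‖w‖⁻¹ = ρ * ∫ w in Metric.ball (0 : ℂ) 1, ‖w‖⁻¹ := by
  have h := Measure.setIntegral_comp_smul_of_pos (volume : Measure ℂ) (fun w : ℂ => ‖w‖⁻¹)
    (Metric.ball 0 1) hρ
  simp only [norm_smul, Real.norm_of_nonneg hρ.le, mul_inv, Complex.finrank_real_complex,
    smul_eq_mul, smul_unitBall_of_pos hρ, integral_const_mul] at h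
  set I := ∫ w in Metric.ball (0 : ℂ) 1, ‖w‖⁻¹
  set J := ∫ w in Metric.ball (0 : ℂ) ρ, ‖w‖⁻¹
  field_simp at h
  linarith

lemma integrableOn_inv_norm_cube {R : ℝ} (hR : 0 < R) :
    IntegrableOn (fun w : ℂ => ‖w‖⁻¹ ^ 3) (Metric.ball 0 R)ᶜ := by
  have h : Integrable (fun w : ℂ => (1 + ‖w‖) ^ (-(3 : ℝ))) :=
    integrable_one_add_norm (by rw [Complex.finrank_real_complex]; norm_num)
  refine ((h.const_mul ((1 + R⁻¹) ^ 3)).integrableOn (s := (Metric.ball 0 R)ᶜ)).mono'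
    (by fun_prop) ?_
  refine (ae_restrict_iff' measurableSet_ball.compl).2 (Filter.Eventually.of_forall fun w hw => ?_)
  have hw' : R ≤ ‖w‖ := by simpa using hw
  have hw0 : 0 < ‖w‖ := hR.trans_le hw'
  rw [Real.norm_of_nonneg (by positivity), Real.rpow_neg (by positivity),
    show (3 : ℝ) = (3 : ℕ) by norm_num, Real.rpow_natCast, ← inv_pow, ← mul_pow]
  gcongr
  rw [← div_eq_mul_inv, le_div_iff₀ (by positivity), inv_mul_eq_div, div_le_iff₀ hw0]
  have : 1 ≤ R⁻¹ * ‖w‖ := by rw [inv_mul_eq_div, one_le_div hR]; exact hw'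
  nlinarith

open Pointwise in
lemma setIntegral_compl_ball_inv_norm_cube {R : ℝ} (hR : 0 < R) :
    ∫ w in (Metric.ball (0 : ℂ) R)ᶜ, ‖w‖⁻¹ ^ 3 =
      (∫ w in (Metric.ball (0 : ℂ) 1)ᶜ, ‖w‖⁻¹ ^ 3) / R := by
  have hcompl : R • (Metric.ball (0 : ℂ) 1)ᶜ = (R • Metric.ball (0 : ℂ) 1)ᶜ :=
    Set.image_compl_eq (MulAction.bijective (Units.mk0 R hR.ne'))
  have h := Measure.setIntegral_comp_smul_of_pos (volume : Measure ℂ) (fun w : ℂ => ‖w‖⁻¹ ^ 3)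
    (Metric.ball 0 1)ᶜ hR
  simp only [norm_smul, Real.norm_of_nonneg hR.le, mul_inv, mul_pow, Complex.finrank_real_complex,
    smul_eq_mul, hcompl, smul_unitBall_of_pos hR, integral_const_mul] at h
  set I := ∫ w in (Metric.ball (0 : ℂ) 1)ᶜ, ‖w‖⁻¹ ^ 3
  set J := ∫ w in (Metric.ball (0 : ℂ) R)ᶜ, ‖w‖⁻¹ ^ 3
  field_simp at h ⊢
  linarith

/-- The integral of `1 / |w - q|` over a disk is of the order of the radius, for any center. -/
lemma exists_setIntegral_inv_norm_sub_le : ∃ C : ℝ, 0 ≤ C ∧ ∀ (q c : ℂ) (ρ : ℝ), 0 < ρ →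
    ∫ w in Metric.ball c ρ, ‖w - q‖⁻¹ ≤ C * ρ := by
  refine ⟨(∫ w in Metric.ball (0 : ℂ) 1, ‖w‖⁻¹) + Real.pi, ?_, fun q c ρ hρ => ?_⟩
  · have : 0 ≤ ∫ w in Metric.ball (0 : ℂ) 1, ‖w‖⁻¹ := integral_nonneg fun w => by positivity
    positivity
  have hvol : volume.real (Metric.ball c ρ) = ρ ^ 2 * Real.pi := by
    rw [Measure.real, Complex.volume_ball]
    simp [hρ.le]
  have hq : ∫ w in Metric.ball q ρ, ‖w - q‖⁻¹ = ρ * ∫ w in Metric.ball (0 : ℂ) 1, ‖w‖⁻¹ := by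
    rw [← setIntegral_ball_inv_norm hρ, ← integral_indicator measurableSet_ball,
      ← integral_indicator measurableSet_ball,
      ← integral_sub_right_eq_self ((Metric.ball (0 : ℂ) ρ).indicator fun w => ‖w‖⁻¹) q]
    congr 1 with w
    simp only [Set.indicator, Metric.mem_ball, dist_eq_norm, sub_zero]
  -- Within ρ of q the integral is that of a centered disk; elsewhere the integrand is at most 1/ρ
  -- on an area of πρ².
  have hsplit : ∀ w, ‖w - q‖⁻¹ ≤ (Metric.ball q ρ).indicator (fun w => ‖w - q‖⁻¹) w + ρ⁻¹ := by
    intro w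
    by_cases hw : w ∈ Metric.ball q ρ
    · rw [Set.indicator_of_mem hw]; linarith [inv_pos.2 hρ]
    · rw [Set.indicator_of_notMem hw, zero_add]
      refine inv_anti₀ hρ ?_
      simpa [dist_eq_norm] using hw
  have hc : IntegrableOn (fun _ : ℂ => ρ⁻¹) (Metric.ball c ρ) :=
    integrableOn_const measure_ball_lt_top.ne
  have hi : Integrable ((Metric.ball q ρ).indicator fun w : ℂ => ‖w - q‖⁻¹) :=
    (integrable_indicator_iff measurableSet_ball).2 (integrableOn_inv_norm_sub q q ρ)
  calc ∫ w in Metric.ball c ρ, ‖w - q‖⁻¹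
      ≤ ∫ w in Metric.ball c ρ,
          ((Metric.ball q ρ).indicator (fun w => ‖w - q‖⁻¹) w + ρ⁻¹) :=
        integral_mono (integrableOn_inv_norm_sub q c ρ)
          (hi.integrableOn.add hc) hsplit
    _ = (∫ w in Metric.ball c ρ, (Metric.ball q ρ).indicator (fun w => ‖w - q‖⁻¹) w)
          + ρ * Real.pi := by
        rw [integral_add hi.integrableOn hc, setIntegral_const, hvol, smul_eq_mul]
        field_simp
    _ ≤ (∫ w, (Metric.ball q ρ).indicator (fun w => ‖w - q‖⁻¹) w) + ρ * Real.pi := by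
        refine add_le_add_left (setIntegral_le_integral hi (Filter.Eventually.of_forall fun w => ?_)) _
        exact Set.indicator_nonneg (fun _ _ => by positivity) w
    _ = _ := by rw [integral_indicator measurableSet_ball, hq]; ring

/-! ### The differentials `1 / (w (w - 1) (w - ζ))` -/

section Base

variable {ζ : ℂ}

/-- Partial fractions: the coefficients are the residues at 0, 1 and ζ. At a pole the left side is 0
by the convention for division. -/
lemma norm_base_le (h0 : ζ ≠ 0) (h1 : ζ ≠ 1) (w : ℂ) :
    ‖1 / (w * (w - 1) * (w - ζ))‖ ≤
      ‖1 / ζ‖ * ‖w - 0‖⁻¹ + ‖1 / (1 - ζ)‖ * ‖w - 1‖⁻¹ + ‖1 / (ζ * (ζ - 1))‖ * ‖w - ζ‖⁻¹ := by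
  by_cases hw : w * (w - 1) * (w - ζ) = 0
  · rw [hw]; simp only [div_zero, norm_zero]; positivity
  · have hw0 : w ≠ 0 := fun h => hw (by simp [h])
    have hw1 : w - 1 ≠ 0 := fun h => hw (by simp [h])
    have hwz : w - ζ ≠ 0 := fun h => hw (by simp [h])
    have hz1 : ζ - 1 ≠ 0 := sub_ne_zero.2 h1
    have hz1' : 1 - ζ ≠ 0 := sub_ne_zero.2 h1.symm
    have e : 1 / (w * (w - 1) * (w - ζ)) =
        1 / ζ * (w - 0)⁻¹ + 1 / (1 - ζ) * (w - 1)⁻¹ + 1 / (ζ * (ζ - 1)) * (w - ζ)⁻¹ := by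
      rw [sub_zero, show 1 - ζ = -(ζ - 1) by ring]
      field_simp
      ring
    rw [e]
    refine (norm_add₃_le).trans ?_
    simp only [norm_mul, norm_inv]
    exact le_rfl

lemma norm_base_le_of_large {w : ℂ} (hw : 2 * (1 + ‖ζ‖) ≤ ‖w‖) :
    ‖1 / (w * (w - 1) * (w - ζ))‖ ≤ 4 * ‖w‖⁻¹ ^ 3 := by
  have hz := norm_nonneg ζ
  have hw0 : 0 < ‖w‖ := by linarith
  have h1 : ‖w‖ / 2 ≤ ‖w - 1‖ := by
    have := norm_sub_norm_le w 1
    rw [norm_one] at this; linarith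
  have h2 : ‖w‖ / 2 ≤ ‖w - ζ‖ := by
    have := norm_sub_norm_le w ζ
    linarith
  rw [norm_div, norm_one, norm_mul, norm_mul]
  calc 1 / (‖w‖ * ‖w - 1‖ * ‖w - ζ‖) ≤ 1 / (‖w‖ * (‖w‖ / 2) * (‖w‖ / 2)) := by gcongr
    _ = 4 * ‖w‖⁻¹ ^ 3 := by field_simp; ring

lemma measurable_base : Measurable fun w : ℂ => 1 / (w * (w - 1) * (w - ζ)) := by fun_prop

lemma integrableOn_base_compl_ball {R : ℝ} (hR : 2 * (1 + ‖ζ‖) ≤ R) :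
    IntegrableOn (fun w : ℂ => 1 / (w * (w - 1) * (w - ζ))) (Metric.ball 0 R)ᶜ := by
  have hR0 : 0 < R := by linarith [norm_nonneg ζ]
  refine ((integrableOn_inv_norm_cube hR0).const_mul 4).mono'
    measurable_base.aestronglyMeasurable ?_
  refine (ae_restrict_iff' measurableSet_ball.compl).2 (Filter.Eventually.of_forall fun w hw => ?_)
  exact norm_base_le_of_large (hR.trans (by simpa using hw))

lemma integrableOn_base_bound (q₁ q₂ q₃ c : ℂ) (k₁ k₂ k₃ ρ : ℝ) :
    IntegrableOn (fun w : ℂ => k₁ * ‖w - q₁‖⁻¹ + k₂ * ‖w - q₂‖⁻¹ + k₃ * ‖w - q₃‖⁻¹)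
      (Metric.ball c ρ) :=
  (((integrableOn_inv_norm_sub q₁ c ρ).const_mul k₁).add
    ((integrableOn_inv_norm_sub q₂ c ρ).const_mul k₂)).add
    ((integrableOn_inv_norm_sub q₃ c ρ).const_mul k₃)

lemma integrable_base (h0 : ζ ≠ 0) (h1 : ζ ≠ 1) :
    Integrable fun w : ℂ => 1 / (w * (w - 1) * (w - ζ)) := by
  rw [← integrableOn_univ, ← Set.union_compl_self (Metric.ball (0 : ℂ) (2 * (1 + ‖ζ‖)))]
  refine IntegrableOn.union ?_ (integrableOn_base_compl_ball le_rfl)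
  exact (integrableOn_base_bound _ _ _ _ _ _ _ _).mono' measurable_base.aestronglyMeasurable
    (Filter.Eventually.of_forall fun w => norm_base_le h0 h1 w)

/-- The mass of the differential near a point is of the order of the radius. -/
lemma exists_setIntegral_ball_base_le (h0 : ζ ≠ 0) (h1 : ζ ≠ 1) : ∃ C : ℝ, 0 ≤ C ∧
    ∀ (c : ℂ) (ρ : ℝ), 0 < ρ →
      ∫ w in Metric.ball c ρ, ‖1 / (w * (w - 1) * (w - ζ))‖ ≤ C * ρ := by
  obtain ⟨C, hC, h⟩ := exists_setIntegral_inv_norm_sub_le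
  refine ⟨(‖1 / ζ‖ + ‖1 / (1 - ζ)‖ + ‖1 / (ζ * (ζ - 1))‖) * C, by positivity, fun c ρ hρ => ?_⟩
  calc _ ≤ ∫ w in Metric.ball c ρ, (‖1 / ζ‖ * ‖w - 0‖⁻¹ + ‖1 / (1 - ζ)‖ * ‖w - 1‖⁻¹
        + ‖1 / (ζ * (ζ - 1))‖ * ‖w - ζ‖⁻¹) :=
        integral_mono (integrable_base h0 h1).norm.integrableOn
          (integrableOn_base_bound _ _ _ _ _ _ _ _) fun w => norm_base_le h0 h1 w
    _ = ‖1 / ζ‖ * (∫ w in Metric.ball c ρ, ‖w - 0‖⁻¹)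
        + ‖1 / (1 - ζ)‖ * (∫ w in Metric.ball c ρ, ‖w - 1‖⁻¹)
        + ‖1 / (ζ * (ζ - 1))‖ * (∫ w in Metric.ball c ρ, ‖w - ζ‖⁻¹) := by
        rw [integral_add, integral_add, integral_const_mul, integral_const_mul, integral_const_mul]
        · exact (integrableOn_inv_norm_sub 0 c ρ).const_mul _
        · exact (integrableOn_inv_norm_sub 1 c ρ).const_mul _
        · exact ((integrableOn_inv_norm_sub 0 c ρ).const_mul _).add
            ((integrableOn_inv_norm_sub 1 c ρ).const_mul _)
        · exact (integrableOn_inv_norm_sub ζ c ρ).const_mul _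
    _ ≤ ‖1 / ζ‖ * (C * ρ) + ‖1 / (1 - ζ)‖ * (C * ρ) + ‖1 / (ζ * (ζ - 1))‖ * (C * ρ) := by
        gcongr <;> exact h _ _ _ hρ
    _ = _ := by ring

/-- The mass of the differential near `∞` is of the order of the inverse radius. -/
lemma exists_setIntegral_compl_ball_base_le (h0 : ζ ≠ 0) (h1 : ζ ≠ 1) : ∃ C : ℝ, 0 ≤ C ∧
    ∀ R : ℝ, 2 * (1 + ‖ζ‖) ≤ R →
      ∫ w in (Metric.ball 0 R)ᶜ, ‖1 / (w * (w - 1) * (w - ζ))‖ ≤ C / R := by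
  refine ⟨4 * ∫ w in (Metric.ball (0 : ℂ) 1)ᶜ, ‖w‖⁻¹ ^ 3, ?_, fun R hR => ?_⟩
  · have : 0 ≤ ∫ w in (Metric.ball (0 : ℂ) 1)ᶜ, ‖w‖⁻¹ ^ 3 := integral_nonneg fun w => by positivity
    positivity
  have hR0 : 0 < R := by linarith [norm_nonneg ζ]
  rw [mul_div_assoc, ← setIntegral_compl_ball_inv_norm_cube hR0, ← integral_const_mul]
  refine setIntegral_mono_on (integrable_base h0 h1).norm.integrableOn
    ((integrableOn_inv_norm_cube hR0).const_mul 4) measurableSet_ball.compl fun w hw => ?_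
  exact norm_base_le_of_large (hR.trans (by simpa using hw))

/-- Away from its poles the differential has small relative oscillation. -/
lemma norm_base_sub_le {w w' : ℂ} {ε ρ : ℝ} (hρ : 0 < ρ) (hε : ε ≤ ρ) (hd : dist w w' ≤ ε)
    (hw' : ∀ p ∈ ({0, 1, ζ} : Set ℂ), ρ ≤ dist w' p) (hw : ∀ p ∈ ({0, 1, ζ} : Set ℂ), ρ ≤ dist w p) :
    ‖1 / (w * (w - 1) * (w - ζ)) - 1 / (w' * (w' - 1) * (w' - ζ))‖ ≤
      7 * (ε / ρ) * ‖1 / (w * (w - 1) * (w - ζ))‖ := by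
  set η := ε / ρ with hη
  have hε0 : 0 ≤ ε := dist_nonneg.trans hd
  have hη0 : 0 ≤ η := by positivity
  have hη1 : η ≤ 1 := (div_le_one hρ).2 hε
  have hne : ∀ p ∈ ({0, 1, ζ} : Set ℂ), w' - p ≠ 0 := by
    intro p hp h
    have := hw' p hp
    rw [sub_eq_zero.1 h, dist_self] at this
    linarith
  have hnew : ∀ p ∈ ({0, 1, ζ} : Set ℂ), w - p ≠ 0 := by
    intro p hp h
    have := hw p hp
    rw [sub_eq_zero.1 h, dist_self] at this
    linarith
  have hu : ∀ p ∈ ({0, 1, ζ} : Set ℂ), ‖(w - w') / (w' - p)‖ ≤ η := by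
    intro p hp
    rw [norm_div, ← dist_eq_norm, ← dist_eq_norm]
    exact div_le_div₀ hε0 hd hρ (hw' p hp)
  have m0 : (0 : ℂ) ∈ ({0, 1, ζ} : Set ℂ) := by simp
  have m1 : (1 : ℂ) ∈ ({0, 1, ζ} : Set ℂ) := by simp
  have m2 : ζ ∈ ({0, 1, ζ} : Set ℂ) := by simp
  have u0 := hu 0 m0
  have u1 := hu 1 m1
  have u2 := hu ζ m2
  have n0 := hne 0 m0
  have n1 := hne 1 m1
  have n2 := hne ζ m2
  have v0 := hnew 0 m0
  have v1 := hnew 1 m1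
  have v2 := hnew ζ m2
  set a := (w - w') / (w' - 0) with ha
  set b := (w - w') / (w' - 1) with hb
  set c := (w - w') / (w' - ζ) with hc
  rw [sub_zero] at n0 v0 ha
  -- Each factor satisfies w - p = (w' - p)(1 + relative shift), so the quotient of the two values
  -- is (1 + a)(1 + b)(1 + c). Its seven nonconstant monomials, each at most η, give the constant 7.
  have e : 1 / (w * (w - 1) * (w - ζ)) - 1 / (w' * (w' - 1) * (w' - ζ)) =
      -(1 / (w * (w - 1) * (w - ζ)) * (a + b + c + a * b + a * c + b * c + a * b * c)) := by
    have e0 : w = w' * (1 + a) := by rw [ha]; field_simp; ring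
    have e1 : w - 1 = (w' - 1) * (1 + b) := by rw [hb]; field_simp; ring
    have e2 : w - ζ = (w' - ζ) * (1 + c) := by rw [hc]; field_simp; ring
    have e3 : 1 / (w' * (w' - 1) * (w' - ζ)) =
        1 / (w * (w - 1) * (w - ζ)) * ((1 + a) * (1 + b) * (1 + c)) := by
      rw [one_div_mul_eq_div, div_eq_div_iff (by positivity) (by positivity), one_mul]
      calc w * (w - 1) * (w - ζ) = w' * (1 + a) * ((w' - 1) * (1 + b)) * ((w' - ζ) * (1 + c)) := by
            rw [← e0, ← e1, ← e2]
        _ = _ := by ring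
    rw [e3]; ring
  rw [e, norm_neg, norm_mul, mul_comm]
  gcongr
  have hab : ‖a * b‖ ≤ η := by
    rw [norm_mul]; nlinarith [norm_nonneg a, norm_nonneg b]
  have hac : ‖a * c‖ ≤ η := by
    rw [norm_mul]; nlinarith [norm_nonneg a, norm_nonneg c]
  have hbc : ‖b * c‖ ≤ η := by
    rw [norm_mul]; nlinarith [norm_nonneg b, norm_nonneg c]
  have habc : ‖a * b * c‖ ≤ η := by
    rw [norm_mul]; nlinarith [norm_nonneg (a * b), norm_nonneg c]
  calc ‖a + b + c + a * b + a * c + b * c + a * b * c‖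
      ≤ ‖a‖ + ‖b‖ + ‖c‖ + ‖a * b‖ + ‖a * c‖ + ‖b * c‖ + ‖a * b * c‖ := by
        refine (norm_add_le _ _).trans (add_le_add_left ?_ _)
        refine (norm_add_le _ _).trans (add_le_add_left ?_ _)
        refine (norm_add_le _ _).trans (add_le_add_left ?_ _)
        refine (norm_add_le _ _).trans (add_le_add_left ?_ _)
        exact norm_add₃_le
    _ ≤ 7 * η := by linarith

end Base

/-! ### The differentials `φ_k` -/

section Phi

variable {m : ℕ} {z : Fin m → ℂ}

lemma phi_eq (k : Fin m) (w : ℂ) :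
    phi z k w = (eta z k : ℂ) * (1 / (w * (w - 1) * (w - z k))) := by
  rw [phi, mul_one_div]

lemma finite_punctures (z : Fin m → ℂ) : (punctures z).Finite :=
  (Set.toFinite {(0 : ℂ), 1}).union (Set.finite_range z)

lemma ae_notMem_punctures (z : Fin m → ℂ) : ∀ᵐ w : ℂ, w ∉ punctures z :=
  measure_eq_zero_iff_ae_notMem.1 ((finite_punctures z).measure_zero _)

lemma ne_of_notMem_punctures {w : ℂ} (hw : w ∉ punctures z) :
    w ≠ 0 ∧ w - 1 ≠ 0 ∧ ∀ k, w - z k ≠ 0 := by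
  simp only [punctures, Set.mem_union, Set.mem_insert_iff, Set.mem_singleton_iff, Set.mem_range,
    not_or, not_exists] at hw
  exact ⟨hw.1.1, sub_ne_zero.2 hw.1.2, fun k => sub_ne_zero.2 (Ne.symm (hw.2 k))⟩

lemma differentiableOn_phi (k : Fin m) : DifferentiableOn ℂ (phi z k) (punctures z)ᶜ := by
  intro w hw
  obtain ⟨h0, h1, h2⟩ := ne_of_notMem_punctures hw
  unfold phi
  have : w * (w - 1) * (w - z k) ≠ 0 := mul_ne_zero (mul_ne_zero h0 h1) (h2 k)
  fun_prop (disch := assumption)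

variable (hz0 : ∀ i, z i ≠ 0) (hz1 : ∀ i, z i ≠ 1)
include hz0 hz1

lemma integrable_phi (k : Fin m) : Integrable (phi z k) := by
  simp_rw [funext (phi_eq (z := z) k)]
  exact (integrable_base (hz0 k) (hz1 k)).const_mul _

lemma eta_pos (k : Fin m) : 0 < eta z k := by
  refine inv_pos.2 ((integral_pos_iff_support_of_nonneg (fun w => norm_nonneg _)
    (integrable_base (hz0 k) (hz1 k)).norm).2 ?_)
  have hsub : (punctures z)ᶜ ⊆ Function.support fun w : ℂ => ‖1 / (w * (w - 1) * (w - z k))‖ := by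
    intro w hw
    obtain ⟨h0, h1, h2⟩ := ne_of_notMem_punctures hw
    rw [Function.mem_support]
    exact norm_ne_zero_iff.2 (one_div_ne_zero (mul_ne_zero (mul_ne_zero h0 h1) (h2 k)))
  refine lt_of_lt_of_le ?_ (measure_mono hsub)
  rw [measure_compl (finite_punctures z).measurableSet (by simp [(finite_punctures z).measure_zero]),
    (finite_punctures z).measure_zero]
  simp

lemma norm_phi (k : Fin m) (w : ℂ) :
    ‖phi z k w‖ = eta z k * ‖1 / (w * (w - 1) * (w - z k))‖ := by
  rw [phi_eq, norm_mul, Complex.norm_real, Real.norm_of_nonneg (eta_pos hz0 hz1 k).le]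

lemma integral_norm_phi (k : Fin m) : ∫ w, ‖phi z k w‖ = 1 := by
  simp_rw [norm_phi hz0 hz1]
  rw [integral_const_mul]
  have := eta_pos hz0 hz1 k
  rw [eta] at this ⊢
  exact inv_mul_cancel₀ (inv_pos.1 this).ne'

lemma phi_mem_quadDiff (k : Fin m) : phi z k ∈ QuadDiff z :=
  ⟨differentiableOn_phi k, integrable_phi hz0 hz1 k⟩

/-- A nontrivial combination of the `φ_k` vanishes only at finitely many points. -/
lemma ae_sum_phi_ne_zero (hz : Function.Injective z) {x : Fin m → ℂ} (hx : x ≠ 0) :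
    ∀ᵐ w : ℂ, ∑ k, x k * phi z k w ≠ 0 := by
  classical
  obtain ⟨i, hi⟩ := Function.ne_iff.1 hx
  -- The numerator over the common denominator w (w - 1) ∏ (w - z_j). At z_i only the i-th term
  -- survives, so P is not the zero polynomial.
  let P : Polynomial ℂ := ∑ k, Polynomial.C (x k * eta z k) *
    ∏ j ∈ Finset.univ.erase k, (Polynomial.X - Polynomial.C (z j))
  have hP : P ≠ 0 := by
    intro h0
    have h1 : P.eval (z i) = x i * eta z i * ∏ j ∈ Finset.univ.erase i, (z i - z j) := by
      simp only [P, Polynomial.eval_finsetSum, Polynomial.eval_mul, Polynomial.eval_C,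
        Polynomial.eval_prod, Polynomial.eval_sub, Polynomial.eval_X]
      refine Finset.sum_eq_single i (fun k _ hk => ?_) (by simp)
      rw [Finset.prod_eq_zero (i := i) (by simp [hk.symm]) (sub_self _), mul_zero]
    rw [h0, Polynomial.eval_zero] at h1
    refine mul_ne_zero (mul_ne_zero hi ?_) (Finset.prod_ne_zero_iff.2 fun j hj => ?_) h1.symm
    · exact_mod_cast (eta_pos hz0 hz1 i).ne'
    · exact sub_ne_zero.2 fun h => (Finset.ne_of_mem_erase hj) (hz h).symm
  have hroots : ∀ᵐ w : ℂ, w ∉ {w | P.IsRoot w} :=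
    measure_eq_zero_iff_ae_notMem.1 ((P.finite_setOfPred_isRoot hP).measure_zero _)
  filter_upwards [hroots, ae_notMem_punctures z] with w hw hwp h
  obtain ⟨h0, h1, h2⟩ := ne_of_notMem_punctures hwp
  refine hw ?_
  change P.eval w = 0
  have : P.eval w = w * (w - 1) * (∏ j, (w - z j)) * ∑ k, x k * phi z k w := by
    simp only [P, Polynomial.eval_finsetSum, Polynomial.eval_mul, Polynomial.eval_C,
      Polynomial.eval_prod, Polynomial.eval_sub, Polynomial.eval_X]
    rw [Finset.mul_sum]
    refine Finset.sum_congr rfl fun k _ => ?_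
    rw [← Finset.mul_prod_erase Finset.univ (fun j => w - z j) (Finset.mem_univ k), phi]
    have := h2 k
    field_simp
  rw [this, h, mul_zero]

end Phi

end Inext

/-! ### The space A(R) is spanned by the φ_k. -/

namespace Inext

open Filter Topology

/-! ### Decay of integrable holomorphic functions -/

/-- A form of the area mean value inequality. -/
lemma sq_mul_norm_le_setIntegral {f : ℂ → ℂ} {c : ℂ} {R : ℝ} (hR : 0 < R)
    (hd : DifferentiableOn ℂ f (Metric.ball c R)) (hi : IntegrableOn f (Metric.ball c R)) :
    R ^ 2 * ‖f c‖ ≤ ∫ w in Metric.ball c R, ‖f w‖ := by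
  classical
  have hπ := Real.pi_gt_three
  let F : ℂ → ℂ := (Metric.ball c R).indicator f
  have hF : Measurable F := by
    have := hd.continuousOn.measurable_piecewise (g := 0) continuousOn_const
      measurableSet_ball
    rwa [Set.piecewise_eq_indicator] at this
  have hcircle : ∀ r ∈ Set.Ioo (R / 2) R, ENNReal.ofReal (2 * Real.pi) * ‖f c‖ₑ ≤
      ∫⁻ θ in Set.Ioo (-Real.pi) Real.pi, ‖F (c + Complex.polarCoord.symm (r, θ))‖ₑ := by
    intro r hr
    have hr0 : 0 < r := by linarith [hr.1]
    have hsub : Metric.closedBall c r ⊆ Metric.ball c R := Metric.closedBall_subset_ball hr.2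
    have hmem : ∀ θ, circleMap c r θ ∈ Metric.ball c R := fun θ =>
      hsub (Metric.sphere_subset_closedBall (circleMap_mem_sphere c hr0.le θ))
    have havg : Real.circleAverage f c r = f c := by
      refine DiffContOnCl.circleAverage ?_
      rw [abs_of_pos hr0]
      exact (hd.mono hsub).diffContOnCl_ball subset_rfl
    have hint : ∫ θ in Set.Ioo (-Real.pi) Real.pi, f (circleMap c r θ) = (2 * Real.pi) • f c := by
      rw [← havg, Real.circleAverage_eq_integral_add (-Real.pi), smul_smul,
        mul_inv_cancel₀ (by positivity), one_smul,
        intervalIntegral.integral_comp_add_right (fun θ => f (circleMap c r θ)),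
        intervalIntegral.integral_of_le (by linarith), ← integral_Ioc_eq_integral_Ioo]
      congr 3 <;> ring
    calc ENNReal.ofReal (2 * Real.pi) * ‖f c‖ₑ
        = ‖∫ θ in Set.Ioo (-Real.pi) Real.pi, f (circleMap c r θ)‖ₑ := by
          rw [hint, enorm_smul, Real.enorm_of_nonneg (by positivity)]
      _ ≤ ∫⁻ θ in Set.Ioo (-Real.pi) Real.pi, ‖f (circleMap c r θ)‖ₑ :=
          enorm_integral_le_lintegral_enorm _
      _ = _ := by
          refine lintegral_congr fun θ => ?_
          have : c + Complex.polarCoord.symm (r, θ) = circleMap c r θ := by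
            rw [Complex.polarCoord_symm_apply, circleMap, Complex.exp_mul_I]
            push_cast; rfl
          rw [this]
          simp only [F]
          rw [Set.indicator_of_mem (hmem θ)]
  have hlow : ENNReal.ofReal (R ^ 2) * ‖f c‖ₑ ≤ ∫⁻ w in Metric.ball c R, ‖f w‖ₑ := by
    -- Averaging only over circles of radius between R/2 and R loses a factor, but (R/2)(2π)(R/2) =
    -- πR²/2 still exceeds R².
    calc ENNReal.ofReal (R ^ 2) * ‖f c‖ₑ
        ≤ ENNReal.ofReal (R / 2) * (ENNReal.ofReal (2 * Real.pi) * ‖f c‖ₑ)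
            * ENNReal.ofReal (R / 2) := by
          rw [mul_comm _ (ENNReal.ofReal (R / 2)), ← mul_assoc, ← mul_assoc,
            ← ENNReal.ofReal_mul (by positivity), ← ENNReal.ofReal_mul (by positivity)]
          gcongr
          nlinarith [sq_nonneg R]
      _ = ∫⁻ _r in Set.Ioo (R / 2) R,
            ENNReal.ofReal (R / 2) * (ENNReal.ofReal (2 * Real.pi) * ‖f c‖ₑ) := by
          rw [setLIntegral_const, Real.volume_Ioo]; congr 2; ring
      _ ≤ ∫⁻ r in Set.Ioo (R / 2) R, ∫⁻ θ in Set.Ioo (-Real.pi) Real.pi,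
            ENNReal.ofReal r * ‖F (c + Complex.polarCoord.symm (r, θ))‖ₑ := by
          refine setLIntegral_mono' measurableSet_Ioo fun r hr => ?_
          rw [lintegral_const_mul' _ _ ENNReal.ofReal_ne_top]
          gcongr
          · exact hr.1.le
          · exact hcircle r hr
      _ ≤ ∫⁻ r in Set.Ioi (0 : ℝ), ∫⁻ θ in Set.Ioo (-Real.pi) Real.pi,
            ENNReal.ofReal r * ‖F (c + Complex.polarCoord.symm (r, θ))‖ₑ :=
          lintegral_mono_set fun r hr => by
            have := hr.1
            rw [Set.mem_Ioi]; linarith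
      _ = ∫⁻ p in polarCoord.target,
            ENNReal.ofReal p.1 • ‖F (c + Complex.polarCoord.symm p)‖ₑ := by
          rw [polarCoord_target, Measure.volume_eq_prod, setLIntegral_prod]
          · rfl
          · refine Measurable.aemeasurable ?_
            simp only [Complex.polarCoord_symm_apply, smul_eq_mul]
            refine Measurable.mul (by fun_prop) (Measurable.enorm (hF.comp ?_))
            fun_prop
      _ = ∫⁻ w, ‖F w‖ₑ := by
          rw [Complex.lintegral_comp_polarCoord_symm fun w => ‖F (c + w)‖ₑ,
            lintegral_add_left_eq_self fun w => ‖F w‖ₑ]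
      _ = ∫⁻ w in Metric.ball c R, ‖f w‖ₑ := by
          rw [← lintegral_indicator measurableSet_ball]
          refine lintegral_congr fun w => ?_
          exact enorm_indicator_eq_indicator_enorm f _
  rw [← ofReal_integral_norm_eq_lintegral_enorm hi, ← ofReal_norm,
    ← ENNReal.ofReal_mul (by positivity)] at hlow
  exact (ENNReal.ofReal_le_ofReal_iff (integral_nonneg fun w => norm_nonneg _)).1 hlow

variable {m : ℕ} {z : Fin m → ℂ}

/-- The mean value inequality on the disk about w of radius |w - p| bounds the expression by the
mass of φ in a disk shrinking to p, which tends to 0. So φ has at most simple poles. -/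
lemma QuadDiff.tendsto_sq_mul {φ : ℂ → ℂ} (hφ : φ ∈ QuadDiff z) (p : ℂ) :
    Tendsto (fun w => (w - p) ^ 2 * φ w) (𝓝[≠] p) (𝓝 0) := by
  have hU : (punctures z \ {p})ᶜ ∈ 𝓝 p :=
    ((finite_punctures z).sdiff.isClosed.isOpen_compl).mem_nhds (by simp)
  obtain ⟨d, hd, hdU⟩ := Metric.mem_nhds_iff.1 hU
  have hlim : Tendsto (fun w => ∫ y in Metric.ball p (2 * dist w p), ‖φ y‖) (𝓝[≠] p) (𝓝 0) := by
    refine hφ.2.norm.tendsto_setIntegral_nhds_zero ?_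
    have : (volume : Measure ℂ) ∘ (fun w => Metric.ball p (2 * dist w p)) =
        fun w => ENNReal.ofReal (2 * dist w p) ^ 2 * NNReal.pi := by
      ext w; simp only [Function.comp, Complex.volume_ball]
    rw [this]
    have hc : Continuous fun w : ℂ => ENNReal.ofReal (2 * dist w p) ^ 2 * NNReal.pi := by
      refine ENNReal.continuous_mul_const (by simp) |>.comp ?_
      exact (ENNReal.continuous_pow 2).comp (ENNReal.continuous_ofReal.comp (by fun_prop))
    have := hc.tendsto p
    simp only [dist_self, mul_zero, ENNReal.ofReal_zero] at this
    exact tendsto_nhdsWithin_of_tendsto_nhds (by simpa using this)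
  refine squeeze_zero_norm' ?_ hlim
  filter_upwards [self_mem_nhdsWithin,
    mem_nhdsWithin_of_mem_nhds (Metric.ball_mem_nhds p (half_pos hd))] with w hwp hwd
  have hwp' : 0 < dist w p := dist_pos.2 hwp
  have hwd' : dist w p < d / 2 := hwd
  have hsub : Metric.ball w (dist w p) ⊆ Metric.ball p (2 * dist w p) :=
    Metric.ball_subset_ball' (by linarith)
  have hsub' : Metric.ball w (dist w p) ⊆ (punctures z)ᶜ := by
    intro y hy hyz
    have h1 : y ∈ Metric.ball p d := Metric.ball_subset_ball (by linarith) (hsub hy)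
    refine hdU h1 ⟨hyz, ?_⟩
    rintro rfl
    rw [Metric.mem_ball, dist_comm] at hy
    exact lt_irrefl _ hy
  have := sq_mul_norm_le_setIntegral hwp' (hφ.1.mono hsub') hφ.2.integrableOn
  rw [norm_mul, norm_pow, ← dist_eq_norm]
  exact this.trans (setIntegral_mono_set hφ.2.norm.integrableOn
    (Eventually.of_forall fun _ => norm_nonneg _) hsub.eventuallyLE)

/-- The same bound on the disk about w of radius |w|/2, now by the mass outside a growing disk; the
half radius costs the factor 4. -/
lemma QuadDiff.tendsto_sq_mul_cocompact {φ : ℂ → ℂ} (hφ : φ ∈ QuadDiff z) :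
    Tendsto (fun w => w ^ 2 * φ w) (cocompact ℂ) (𝓝 0) := by
  obtain ⟨B, hB⟩ := (finite_punctures z).isBounded.subset_ball 0
  have hn := tendsto_norm_cocompact_atTop (E := ℂ)
  have hlim : Tendsto (fun w : ℂ => 4 * ∫ y in (Metric.ball 0 (‖w‖ / 2))ᶜ, ‖φ y‖)
      (cocompact ℂ) (𝓝 0) := by
    have h1 : Tendsto (fun r : ℝ => ∫ y in Metric.ball (0 : ℂ) r, ‖φ y‖) atTop
        (𝓝 (∫ y, ‖φ y‖)) :=
      (aecover_ball tendsto_id).integral_tendsto_of_countably_generated hφ.2.norm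
    have h2 : Tendsto (fun w : ℂ => 4 * ((∫ y, ‖φ y‖) - ∫ y in Metric.ball (0 : ℂ) (‖w‖ / 2), ‖φ y‖))
        (cocompact ℂ) (𝓝 (4 * ((∫ y, ‖φ y‖) - ∫ y, ‖φ y‖))) :=
      (tendsto_const_nhds.sub (h1.comp (hn.atTop_div_const two_pos))).const_mul 4
    rw [sub_self, mul_zero] at h2
    refine h2.congr fun w => ?_
    rw [setIntegral_compl measurableSet_ball hφ.2.norm]
  refine squeeze_zero_norm' ?_ hlim
  filter_upwards [hn.eventually_ge_atTop (2 * B), hn.eventually_gt_atTop 0] with w hw hw0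
  have hsub : Metric.ball w (‖w‖ / 2) ⊆ (Metric.ball 0 (‖w‖ / 2))ᶜ := by
    intro y hy
    rw [Metric.mem_ball, dist_eq_norm, norm_sub_rev] at hy
    simp only [Set.mem_compl_iff, Metric.mem_ball, dist_zero_right, not_lt]
    linarith [norm_sub_norm_le w y]
  have hsub' : Metric.ball w (‖w‖ / 2) ⊆ (punctures z)ᶜ := fun y hy hyz =>
    hsub hy (Metric.ball_subset_ball (by linarith) (hB hyz))
  have := sq_mul_norm_le_setIntegral (half_pos hw0) (hφ.1.mono hsub') hφ.2.integrableOn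
  have h2 := this.trans (setIntegral_mono_set hφ.2.norm.integrableOn
    (Eventually.of_forall fun _ => norm_nonneg _) hsub.eventuallyLE)
  rw [norm_mul, norm_pow]
  linarith

/-! ### Removable singularities -/

lemma isLittleO_of_tendsto_mul {f : ℂ → ℂ} {p : ℂ}
    (h : Tendsto (fun w => (w - p) * f w) (𝓝[≠] p) (𝓝 0)) :
    (fun w => f w - f p) =o[𝓝[≠] p] fun w => (w - p)⁻¹ := by
  refine (Asymptotics.isLittleO_iff_tendsto' ?_).2 ?_
  · filter_upwards [self_mem_nhdsWithin] with w hw h0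
    exact absurd (inv_eq_zero.1 h0) (sub_ne_zero.2 hw)
  · have h1 : Tendsto (fun w => (w - p) * f p) (𝓝[≠] p) (𝓝 0) := by
      have : Continuous fun w => (w - p) * f p := by fun_prop
      exact tendsto_nhdsWithin_of_tendsto_nhds (by simpa using this.tendsto p)
    have h2 := h.sub h1
    rw [sub_zero] at h2
    refine h2.congr fun w => ?_
    rw [div_inv_eq_mul]; ring

/-- A holomorphic function with finitely many singularities, all removable, extends. -/
lemma exists_entire_extension {S : Set ℂ} (hS : S.Finite) {f : ℂ → ℂ}
    (hd : DifferentiableOn ℂ f Sᶜ)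
    (h : ∀ p ∈ S, Tendsto (fun w => (w - p) * f w) (𝓝[≠] p) (𝓝 0)) :
    ∃ g : ℂ → ℂ, Differentiable ℂ g ∧ ∀ w ∉ S, g w = f w := by
  classical
  refine ⟨fun w => if w ∈ S then limUnder (𝓝[≠] w) f else f w, fun p => ?_,
    fun w hw => if_neg hw⟩
  by_cases hp : p ∈ S
  · have hU : (S \ {p})ᶜ ∈ 𝓝 p := (hS.sdiff.isClosed.isOpen_compl).mem_nhds (by simp)
    have hdiff := Complex.differentiableOn_update_limUnder_of_isLittleO hU
      (hd.mono fun w hw hwS => hw.1 ⟨hwS, hw.2⟩) (isLittleO_of_tendsto_mul (h p hp))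
    refine (hdiff.differentiableAt hU).congr_of_eventuallyEq ?_
    filter_upwards [hU] with w hw
    by_cases hwp : w = p
    · subst hwp; simp [hp]
    · have : w ∉ S := fun hwS => hw ⟨hwS, hwp⟩
      simp [this, hwp]
  · have hU : Sᶜ ∈ 𝓝 p := hS.isClosed.isOpen_compl.mem_nhds hp
    refine (hd.differentiableAt hU).congr_of_eventuallyEq ?_
    filter_upwards [hU] with w hw
    exact if_neg hw

/-- Every integrable holomorphic quadratic differential is a combination of the `φ_k`. -/
theorem QuadDiff.exists_eq_sum_phi (hz : Function.Injective z) (hz0 : ∀ i, z i ≠ 0)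
    (hz1 : ∀ i, z i ≠ 1) {φ : ℂ → ℂ} (hφ : φ ∈ QuadDiff z) :
    ∃ x : Fin m → ℂ, ∀ w ∉ punctures z, φ w = ∑ k, x k * phi z k w := by
  have hopen : IsOpen (punctures z)ᶜ := (finite_punctures z).isClosed.isOpen_compl
  have hres : ∀ k, ∃ r : ℂ, Tendsto (fun w => (w - z k) * φ w) (𝓝[≠] (z k)) (𝓝 r) := by
    intro k
    refine ⟨_, Complex.tendsto_limUnder_of_differentiable_on_punctured_nhds_of_isLittleO ?_
      (isLittleO_of_tendsto_mul ?_)⟩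
    · have hU : (punctures z \ {z k})ᶜ ∈ 𝓝 (z k) :=
        ((finite_punctures z).sdiff.isClosed.isOpen_compl).mem_nhds (by simp)
      filter_upwards [self_mem_nhdsWithin, mem_nhdsWithin_of_mem_nhds hU] with w hw hwU
      have hwp : w ∈ (punctures z)ᶜ := fun h => hwU ⟨h, hw⟩
      have := hφ.1.differentiableAt (hopen.mem_nhds hwp)
      fun_prop
    · refine (QuadDiff.tendsto_sq_mul hφ (z k)).congr fun w => ?_
      ring
  choose r hr using hres
  -- The residue of φ_k at z_k is η_k / (z_k (z_k - 1)), so x_k φ_k has the residue r_k of φ there.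
  set x : Fin m → ℂ := fun k => r k * (z k * (z k - 1)) / eta z k with hx
  set ψ : ℂ → ℂ := fun w => φ w - ∑ k, x k * phi z k w with hψ
  have hψQ : ψ ∈ QuadDiff z := by
    refine ⟨hφ.1.sub (DifferentiableOn.fun_sum fun k _ => (differentiableOn_phi k).const_mul _), ?_⟩
    exact hφ.2.sub (integrable_finsetSum _ fun k _ => (integrable_phi hz0 hz1 k).const_mul _)
  have hphi : ∀ k j, Tendsto (fun w => (w - z k) * (x j * phi z j w)) (𝓝[≠] (z k))
      (𝓝 (if j = k then r k else 0)) := by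
    intro k j
    have h0 := hz0 k
    have h1 : z k - 1 ≠ 0 := sub_ne_zero.2 (hz1 k)
    have heta : (eta z k : ℂ) ≠ 0 := by exact_mod_cast (eta_pos hz0 hz1 k).ne'
    by_cases hjk : j = k
    · subst hjk
      rw [if_pos rfl]
      have hc : ContinuousAt (fun w => x j * eta z j / (w * (w - 1))) (z j) :=
        ContinuousAt.div (by fun_prop) (by fun_prop) (mul_ne_zero h0 h1)
      have hv : x j * eta z j / (z j * (z j - 1)) = r j := by
        rw [hx]; field_simp
      have := tendsto_nhdsWithin_of_tendsto_nhds (s := {z j}ᶜ) hc.tendsto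
      rw [hv] at this
      refine this.congr' ?_
      filter_upwards [self_mem_nhdsWithin] with w hw
      have hw' : w - z j ≠ 0 := sub_ne_zero.2 hw
      rw [phi]
      field_simp
    · rw [if_neg hjk]
      have hne : z k - z j ≠ 0 := sub_ne_zero.2 fun h => hjk (hz h).symm
      have hc : ContinuousAt (fun w => (w - z k) * (x j * phi z j w)) (z k) := by
        unfold phi
        have : z k * (z k - 1) * (z k - z j) ≠ 0 := mul_ne_zero (mul_ne_zero h0 h1) hne
        fun_prop (disch := assumption)
      have := tendsto_nhdsWithin_of_tendsto_nhds (s := {z k}ᶜ) hc.tendsto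
      simpa using this
  have hψz : ∀ k, Tendsto (fun w => (w - z k) * ψ w) (𝓝[≠] (z k)) (𝓝 0) := by
    intro k
    have h1 := (hr k).sub (tendsto_finsetSum Finset.univ fun j _ => hphi k j)
    simp only [Finset.sum_ite_eq', Finset.mem_univ, if_true, sub_self] at h1
    refine h1.congr fun w => ?_
    rw [hψ, mul_sub, Finset.mul_sum]
  -- Simple poles of ψ at 0 and 1 may remain; the factor w (w - 1) removes them. The resulting
  -- entire function behaves like w²ψ at ∞, hence tends to 0 and vanishes identically.
  have hH : ∀ p ∈ punctures z,
      Tendsto (fun w => (w - p) * (w * (w - 1) * ψ w)) (𝓝[≠] p) (𝓝 0) := by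
    have hcont : ∀ (p : ℂ) (g : ℂ → ℂ), Continuous g → Tendsto g (𝓝[≠] p) (𝓝 (g p)) :=
      fun p g hg => tendsto_nhdsWithin_of_tendsto_nhds (hg.tendsto p)
    rintro p ((rfl | rfl) | ⟨k, rfl⟩)
    · have := (hcont 0 (fun w => w - 1) (by fun_prop)).mul (QuadDiff.tendsto_sq_mul hψQ 0)
      rw [mul_zero] at this
      exact this.congr fun w => by ring
    · have := (hcont 1 (fun w => w) (by fun_prop)).mul (QuadDiff.tendsto_sq_mul hψQ 1)
      rw [mul_zero] at this
      exact this.congr fun w => by ring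
    · have := (hcont (z k) (fun w => w * (w - 1)) (by fun_prop)).mul (hψz k)
      rw [mul_zero] at this
      exact this.congr fun w => by ring
  obtain ⟨g, hg, hgH⟩ := exists_entire_extension (finite_punctures z)
    (f := fun w => w * (w - 1) * ψ w)
    ((by fun_prop : DifferentiableOn ℂ (fun w : ℂ => w * (w - 1)) _).mul hψQ.1) hH
  have hlim : Tendsto g (cocompact ℂ) (𝓝 0) := by
    have h1 : Tendsto (fun w : ℂ => 1 - w⁻¹) (cocompact ℂ) (𝓝 (1 - 0)) :=
      tendsto_const_nhds.sub (tendsto_inv₀_cobounded.mono_left Metric.cobounded_eq_cocompact.ge)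
    have h2 := h1.mul (QuadDiff.tendsto_sq_mul_cocompact hψQ)
    rw [mul_zero] at h2
    refine h2.congr' ?_
    filter_upwards [(finite_punctures z).isCompact.compl_mem_cocompact] with w hw
    obtain ⟨h0, -, -⟩ := ne_of_notMem_punctures hw
    rw [hgH w hw]
    field_simp
  refine ⟨x, fun w hw => ?_⟩
  obtain ⟨h0, h1, -⟩ := ne_of_notMem_punctures hw
  have h2 := hgH w hw
  rw [hg.apply_eq_of_tendsto_cocompact w hlim] at h2
  have h3 := (mul_eq_zero.1 h2.symm).resolve_left (mul_ne_zero h0 h1)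
  exact sub_eq_zero.1 h3

end Inext

/-! ### Duality between L¹ and L^∞, and the extremal differential. -/

namespace Inext

open Filter Topology

/-! ### The pairing of Beltrami and quadratic differentials -/

lemma Beltrami.ae_norm_le (μ : Beltrami) : ∀ᵐ w : ℂ, ‖μ w‖ ≤ ‖μ‖ := by
  have hfin : eLpNorm μ ⊤ volume ≠ ⊤ := Lp.eLpNorm_ne_top μ
  filter_upwards [ae_le_eLpNormEssSup (f := μ) (μ := volume)] with w hw
  rw [Lp.norm_def, ← toReal_enorm]
  exact ENNReal.toReal_mono hfin (by rwa [eLpNorm_exponent_top])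

lemma Beltrami.norm_le_of_ae {μ : Beltrami} {C : ℝ} (hC : 0 ≤ C) (h : ∀ᵐ w : ℂ, ‖μ w‖ ≤ C) :
    ‖μ‖ ≤ C := by
  rw [Lp.norm_def, eLpNorm_exponent_top]
  exact ENNReal.toReal_le_of_le_ofReal hC (eLpNormEssSup_le_of_ae_bound h)

lemma Beltrami.integrable_mul (μ : Beltrami) {φ : ℂ → ℂ} (hφ : Integrable φ) :
    Integrable fun w => μ w * φ w :=
  hφ.bdd_mul (Lp.aestronglyMeasurable μ) μ.ae_norm_le

lemma Beltrami.norm_integral_mul_le (μ : Beltrami) {φ : ℂ → ℂ} (hφ : Integrable φ) :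
    ‖∫ w, μ w * φ w‖ ≤ ‖μ‖ * ∫ w, ‖φ w‖ := by
  refine (norm_integral_le_integral_norm _).trans ?_
  rw [← integral_const_mul]
  refine integral_mono_ae (μ.integrable_mul hφ).norm (hφ.norm.const_mul _) ?_
  filter_upwards [μ.ae_norm_le] with w hw
  simp only [norm_mul]
  gcongr

/-! ### Combinations of the basic differentials -/

variable {m : ℕ} {z : Fin m → ℂ}

/-- The quadratic differential `∑ x_k φ_k`. -/
noncomputable def comb (z : Fin m → ℂ) (x : Fin m → ℂ) (w : ℂ) : ℂ := ∑ k, x k * phi z k w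

lemma comb_add (x y : Fin m → ℂ) (w : ℂ) : comb z (x + y) w = comb z x w + comb z y w := by
  simp [comb, add_mul, Finset.sum_add_distrib]

lemma comb_smul (c : ℂ) (x : Fin m → ℂ) (w : ℂ) : comb z (c • x) w = c * comb z x w := by
  simp [comb, Finset.mul_sum, mul_assoc]

section

variable (hz0 : ∀ i, z i ≠ 0) (hz1 : ∀ i, z i ≠ 1)
include hz0 hz1

lemma integrable_comb (x : Fin m → ℂ) : Integrable (comb z x) :=
  integrable_finsetSum _ fun k _ => (integrable_phi hz0 hz1 k).const_mul _

/-- The linear map `x ↦ ∑ x_k φ_k` to `L¹`. -/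
noncomputable def combL1 : (Fin m → ℂ) →ₗ[ℂ] (ℂ →₁[volume] ℂ) where
  toFun x := (integrable_comb hz0 hz1 x).toL1 (comb z x)
  map_add' x y := by
    rw [← Integrable.toL1_add, Integrable.toL1_eq_toL1_iff]
    exact Eventually.of_forall fun w => comb_add x y w
  map_smul' c x := by
    rw [RingHom.id_apply, ← Integrable.toL1_smul, Integrable.toL1_eq_toL1_iff]
    exact Eventually.of_forall fun w => comb_smul c x w

lemma norm_combL1 (x : Fin m → ℂ) : ‖combL1 hz0 hz1 x‖ = ∫ w, ‖comb z x w‖ :=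
  L1.norm_of_fun_eq_integral_norm (integrable_comb hz0 hz1 x)

/-- An injective linear map on a finite-dimensional space is bounded below. This yields both the
control of coefficients by the L¹ norm and the coercivity needed for a minimizer. -/
lemma exists_antilipschitzWith_combL1 (hz : Function.Injective z) :
    ∃ K > 0, AntilipschitzWith K (combL1 hz0 hz1) := by
  refine (combL1 hz0 hz1).exists_antilipschitzWith (LinearMap.ker_eq_bot'.2 fun x hx => ?_)
  by_contra hne
  have h0 : comb z x =ᵐ[volume] 0 := by
    have h1 := Integrable.coeFn_toL1 (integrable_comb hz0 hz1 x)
    have h2 : (integrable_comb hz0 hz1 x).toL1 (comb z x) = 0 := hx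
    rw [h2] at h1
    exact h1.symm.trans (Lp.coeFn_zero _ _ _)
  obtain ⟨w, hw, hw'⟩ := (h0.and (ae_sum_phi_ne_zero hz0 hz1 hz hne)).exists
  exact hw' hw

/-- The coefficients of a combination are controlled by its norm. -/
lemma exists_sum_norm_le (hz : Function.Injective z) :
    ∃ M : ℝ, 0 ≤ M ∧ ∀ x : Fin m → ℂ, ∑ k, ‖x k‖ ≤ M * ∫ w, ‖comb z x w‖ := by
  obtain ⟨K, -, hK⟩ := exists_antilipschitzWith_combL1 hz0 hz1 hz
  refine ⟨m * K, by positivity, fun x => ?_⟩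
  have h1 : ‖x‖ ≤ K * ∫ w, ‖comb z x w‖ := by
    have := hK.le_mul_dist x 0
    rwa [map_zero, dist_zero_right, dist_zero_right, norm_combL1] at this
  calc ∑ k, ‖x k‖ ≤ ∑ _k : Fin m, ‖x‖ := Finset.sum_le_sum fun k _ => norm_le_pi_norm x k
    _ = m * ‖x‖ := by simp
    _ ≤ m * (K * ∫ w, ‖comb z x w‖) := by gcongr
    _ = _ := by ring

lemma integral_mul_comb (μ : Beltrami) (x : Fin m → ℂ) :
    ∫ w, μ w * comb z x w = ∑ k, x k * ∫ w, μ w * phi z k w := by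
  simp_rw [comb, Finset.mul_sum]
  rw [integral_finsetSum]
  · refine Finset.sum_congr rfl fun k _ => ?_
    rw [← integral_const_mul]
    congr 1 with w
    ring
  · intro k _
    exact μ.integrable_mul ((integrable_phi hz0 hz1 k).const_mul _)

/-- Infinitesimal equivalence can be tested on the basic differentials. -/
lemma infEquiv_iff (hz : Function.Injective z) {μ ν : Beltrami} :
    InfEquiv z μ ν ↔ ∀ k, ∫ w, μ w * phi z k w = ∫ w, ν w * phi z k w := by
  refine ⟨fun h k => h _ (phi_mem_quadDiff hz0 hz1 k) (integral_norm_phi hz0 hz1 k),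
    fun h φ hφ _ => ?_⟩
  obtain ⟨x, hx⟩ := QuadDiff.exists_eq_sum_phi hz hz0 hz1 hφ
  have hcomb : ∀ β : Beltrami, ∫ w, β w * φ w = ∫ w, β w * comb z x w := by
    intro β
    refine integral_congr_ae ?_
    filter_upwards [ae_notMem_punctures z] with w hw
    rw [hx w hw, comb]
  rw [hcomb, hcomb, integral_mul_comb hz0 hz1, integral_mul_comb hz0 hz1]
  simp_rw [h]

end

/-! ### Existence and uniqueness of the extremal differential -/

/-- First order condition for a minimum of the `L¹` norm on a line. -/
lemma re_integral_eq_zero_of_forall_le {f h : ℂ → ℂ} (hf : Integrable f) (hh : Integrable h)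
    (hf0 : ∀ᵐ w, f w ≠ 0) (hmin : ∀ t : ℝ, ∫ w, ‖f w‖ ≤ ∫ w, ‖f w + t * h w‖) :
    (∫ w, starRingEnd ℂ (f w) / ‖f w‖ * h w).re = 0 := by
  have hF : ∀ t : ℝ, AEStronglyMeasurable (fun w => ‖f w + t * h w‖) volume := fun t =>
    (hf.add (hh.const_mul (t : ℂ))).norm.aestronglyMeasurable
  have hmeas : AEStronglyMeasurable (fun w => starRingEnd ℂ (f w) / ‖f w‖ * h w) volume := by
    have h1 : AEMeasurable f := hf.aemeasurable
    have h2 : AEMeasurable h := hh.aemeasurable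
    have h3 : AEMeasurable fun w => starRingEnd ℂ (f w) :=
      Complex.continuous_conj.measurable.comp_aemeasurable h1
    have h4 : AEMeasurable fun w => ((‖f w‖ : ℝ) : ℂ) :=
      Complex.measurable_ofReal.comp_aemeasurable h1.norm
    exact ((h3.div h4).mul h2).aestronglyMeasurable
  -- The integrand is Lipschitz in t with integrable constant |h|, and differentiable at 0 wherever
  -- f ≠ 0, that is, almost everywhere.
  have key := hasDerivAt_integral_of_dominated_loc_of_lip (μ := (volume : Measure ℂ)) (𝕜 := ℝ)
    (F := fun t w => ‖f w + t * h w‖) (x₀ := 0) (s := Set.univ)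
    (F' := fun w => (starRingEnd ℂ (f w) / ‖f w‖ * h w).re) (bound := fun w => ‖h w‖) univ_mem
    (Eventually.of_forall hF) (by simpa using hf.norm)
    (Complex.continuous_re.comp_aestronglyMeasurable hmeas) ?_ hh.norm ?_
  · have hlocal : IsLocalMin (fun t : ℝ => ∫ w, ‖f w + t * h w‖) 0 := by
      refine Eventually.of_forall fun t => ?_
      simpa using hmin t
    have h0 := hlocal.hasDerivAt_eq_zero key.2
    have hint : Integrable fun w => starRingEnd ℂ (f w) / ‖f w‖ * h w := by
      refine hh.mono hmeas (Eventually.of_forall fun w => ?_)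
      rw [norm_mul, norm_div, RCLike.norm_conj, Complex.norm_real, norm_norm]
      exact mul_le_of_le_one_left (norm_nonneg _) (div_self_le_one _)
    exact (integral_re hint).symm.trans h0
  · refine Eventually.of_forall fun w => LipschitzOnWith.of_dist_le_mul fun s _ t _ => ?_
    rw [Real.coe_nnabs, abs_of_nonneg (norm_nonneg _), Real.dist_eq, Real.dist_eq]
    refine (abs_norm_sub_norm_le _ _).trans (le_of_eq ?_)
    rw [show f w + (s : ℂ) * h w - (f w + (t : ℂ) * h w) = ((s - t : ℝ) : ℂ) * h w by
      push_cast; ring, norm_mul, Complex.norm_real, Real.norm_eq_abs, mul_comm]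
  · filter_upwards [hf0] with w hw
    have h1 : HasDerivAt (fun t : ℝ => f w + t * h w) (h w) 0 := by
      have := ((hasDerivAt_id (0 : ℝ)).ofReal_comp.mul_const (h w)).const_add (f w)
      simpa using this
    have hn : ‖f w‖ ≠ 0 := norm_ne_zero_iff.2 hw
    have h2 := h1.norm_sq.sqrt (by simpa using hw)
    simp only [Real.sqrt_sq (norm_nonneg _), Complex.ofReal_zero, zero_mul, add_zero] at h2
    have h3 : (starRingEnd ℂ (f w) / ‖f w‖ * h w).re = 2 * inner ℝ (f w) (h w) / (2 * ‖f w‖) := by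
      rw [Complex.inner, mul_div_mul_left _ _ two_ne_zero, div_mul_eq_mul_div,
        Complex.div_ofReal_re, mul_comm]
    exact h3 ▸ h2

/-- Almost everywhere uniqueness in the equality case of the pairing inequality. -/
lemma Beltrami.mul_eq_of_integral_eq {β : Beltrami} {f : ℂ → ℂ} (hf : Integrable f) {C : ℝ}
    (hβ : ‖β‖ ≤ C) (h : ∫ w, β w * f w = ((C * ∫ w, ‖f w‖ : ℝ) : ℂ)) :
    ∀ᵐ w, β w * f w = ((C * ‖f w‖ : ℝ) : ℂ) := by
  have hint := β.integrable_mul hf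
  have hle : ∀ᵐ w, ‖β w * f w‖ ≤ C * ‖f w‖ := by
    filter_upwards [β.ae_norm_le] with w hw
    rw [norm_mul]
    gcongr
    exact hw.trans hβ
  -- This nonnegative function has integral 0. Then Re(βf) = C|f| ≥ |βf| almost everywhere, which
  -- forces βf to be real.
  have hnn : 0 ≤ᵐ[volume] fun w => C * ‖f w‖ - (β w * f w).re := by
    filter_upwards [hle] with w hw
    exact sub_nonneg.2 ((Complex.re_le_norm _).trans hw)
  have h0 : ∫ w, (C * ‖f w‖ - (β w * f w).re) = 0 := by
    have hre : ∫ w, (β w * f w).re = (∫ w, β w * f w).re := integral_re hint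
    have hintre : Integrable fun w => (β w * f w).re := hint.re
    rw [integral_sub (hf.norm.const_mul C) hintre, integral_const_mul]
    refine sub_eq_zero.2 (Eq.trans ?_ hre.symm)
    rw [h, Complex.ofReal_re]
  have hzero := (integral_eq_zero_iff_of_nonneg_ae hnn
    ((hf.norm.const_mul C).sub hint.re)).1 h0
  filter_upwards [hzero, hle] with w hw hw'
  have hw0 : C * ‖f w‖ = (β w * f w).re := sub_eq_zero.1 hw
  have hre : (β w * f w).re = ‖β w * f w‖ :=
    le_antisymm (Complex.re_le_norm _) (by rw [← hw0]; exact hw')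
  have h3 := Complex.nonneg_iff.1 (Complex.re_eq_norm.1 hre)
  rw [hw0]
  exact Complex.ext (by simp) (by simpa using h3.2.symm)

/-- The extremal differential has Teichmüller form. With f of least norm N on ∫μφ = 1, the first
order condition makes conj f / |f| annihilate the kernel of the functional φ ↦ ∫μφ, so N⁻¹ conj f /
|f| is equivalent to μ; pairing with f shows that no equivalent differential has norm below N⁻¹. -/
theorem existsUnique_isInfExtremal (hz : Function.Injective z) (hz0 : ∀ i, z i ≠ 0)
    (hz1 : ∀ i, z i ≠ 1) (μ : Beltrami) : ∃! ν : Beltrami, IsInfExtremal z μ ν := by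
  -- When μ annihilates the whole span the hyperplane is empty, and the extremal differential is 0.
  by_cases hμ : ∀ k, ∫ w, μ w * phi z k w = 0
  · have hzero : InfEquiv z 0 μ := by
      refine (infEquiv_iff hz0 hz1 hz).2 fun k => ?_
      rw [hμ k]
      refine integral_eq_zero_of_ae ?_
      filter_upwards [Lp.coeFn_zero ℂ ⊤ (volume : Measure ℂ)] with w hw
      rw [hw]; simp
    refine ⟨0, ⟨hzero, fun β _ => by rw [norm_zero]; exact norm_nonneg β⟩, fun ν hν => ?_⟩
    have := hν.2 0 hzero
    rwa [norm_zero, norm_le_zero_iff] at this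
  push Not at hμ
  obtain ⟨k₀, hk₀⟩ := hμ
  let ℓ : (Fin m → ℂ) →ₗ[ℂ] ℂ := ∑ k, (∫ w, μ w * phi z k w) • LinearMap.proj k
  have hℓ : ∀ x, ℓ x = ∫ w, μ w * comb z x w := by
    intro x
    rw [integral_mul_comb hz0 hz1]
    simp [ℓ, mul_comm]
  obtain ⟨K, -, hK⟩ := exists_antilipschitzWith_combL1 hz0 hz1 hz
  obtain ⟨x, hx1, hxmin⟩ : ∃ x ∈ {x | ℓ x = 1},
      IsMinOn (fun x => ‖combL1 hz0 hz1 x‖) {x | ℓ x = 1} x := by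
    have hcont : Continuous fun x => ‖combL1 hz0 hz1 x‖ :=
      (LinearMap.continuous_of_finiteDimensional _).norm
    refine hcont.continuousOn.exists_isMinOn'
      (isClosed_eq (LinearMap.continuous_of_finiteDimensional ℓ) continuous_const)
      (x₀ := Pi.single k₀ (∫ w, μ w * phi z k₀ w)⁻¹) ?_ ?_
    · change ℓ _ = 1
      simp [ℓ, Pi.single_apply, hk₀]
    · have := tendsto_norm_cobounded_atTop.comp hK.tendsto_cobounded
      rw [Metric.cobounded_eq_cocompact] at this
      exact (this.eventually_ge_atTop _).filter_mono inf_le_left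
  set f := comb z x with hfdef
  have hf : Integrable f := integrable_comb hz0 hz1 x
  have hx0 : x ≠ 0 := by
    rintro rfl
    have : ℓ 0 = 1 := hx1
    simp at this
  have hf0 : ∀ᵐ w, f w ≠ 0 := ae_sum_phi_ne_zero hz0 hz1 hz hx0
  set N := ∫ w, ‖f w‖ with hN
  have hNpos : 0 < N := by
    rw [hN, ← norm_combL1 hz0 hz1, norm_pos_iff]
    intro h0
    exact hx0 (hK.injective (by rw [h0, map_zero]))
  set σ : ℂ → ℂ := fun w => starRingEnd ℂ (f w) / ‖f w‖ with hσ
  have hσ1 : ∀ w, ‖σ w‖ ≤ 1 := by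
    intro w
    rw [hσ, norm_div, RCLike.norm_conj, Complex.norm_real, norm_norm]
    exact div_self_le_one _
  have hσf : ∀ w, σ w * f w = (‖f w‖ : ℂ) := by
    intro w
    by_cases hw : f w = 0
    · simp [hw]
    · have : (‖f w‖ : ℂ) ≠ 0 := by exact_mod_cast norm_ne_zero_iff.2 hw
      simp only [hσ]
      rw [div_mul_eq_mul_div, mul_comm, Complex.mul_conj, Complex.normSq_eq_norm_sq]
      push_cast
      field_simp
  have hσm : AEStronglyMeasurable σ volume := by
    have h1 : AEMeasurable f := hf.aemeasurable
    exact ((Complex.continuous_conj.measurable.comp_aemeasurable h1).div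
      (Complex.measurable_ofReal.comp_aemeasurable h1.norm)).aestronglyMeasurable
  have hσL : MemLp σ ⊤ volume := memLp_top_of_bound hσm 1 (Eventually.of_forall hσ1)
  have hσint : ∀ y, Integrable fun w => σ w * comb z y w := fun y =>
    (integrable_comb hz0 hz1 y).bdd_mul hσm (Eventually.of_forall hσ1)
  have hre : ∀ y, ℓ y = 0 → (∫ w, σ w * comb z y w).re = 0 := by
    intro y hy
    refine re_integral_eq_zero_of_forall_le hf (integrable_comb hz0 hz1 y) hf0 fun t => ?_
    have hmem : x + (t : ℂ) • y ∈ {x | ℓ x = 1} := by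
      change ℓ _ = 1
      rw [map_add, map_smul, hy, smul_zero, add_zero]
      exact hx1
    have := hxmin hmem
    simp only [Set.mem_ofPred_eq, norm_combL1] at this
    refine this.trans (le_of_eq ?_)
    congr 1 with w
    rw [comb_add, comb_smul]
  have hker : ∀ y, ℓ y = 0 → ∫ w, σ w * comb z y w = 0 := by
    intro y hy
    -- The kernel is a complex subspace, so the real part for i y controls the imaginary part for y.
    refine Complex.ext (by rw [hre y hy]; rfl) ?_
    have h1 := hre (Complex.I • y) (by rw [map_smul, hy, smul_zero])
    have h2 : ∫ w, σ w * comb z (Complex.I • y) w = Complex.I * ∫ w, σ w * comb z y w := by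
      rw [← integral_const_mul]
      congr 1 with w
      rw [comb_smul]; ring
    rw [h2, Complex.I_mul_re, neg_eq_zero] at h1
    rw [h1]; rfl
  have hσall : ∀ y, ∫ w, σ w * comb z y w = N * ℓ y := by
    intro y
    have h1 := hker (y + (-ℓ y) • x) (by
      rw [map_add, map_smul, show ℓ x = 1 from hx1]; simp)
    have h2 : ∀ w, σ w * comb z (y + (-ℓ y) • x) w =
        σ w * comb z y w + (-ℓ y) * (σ w * f w) := by
      intro w; rw [comb_add, comb_smul]; ring
    simp_rw [h2] at h1
    have h3 : Integrable fun w => σ w * f w := hσint x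
    rw [integral_add (hσint y) (h3.const_mul _), integral_const_mul] at h1
    simp_rw [hσf] at h1
    rw [integral_complex_ofReal, ← hN] at h1
    linear_combination h1
  let ν : Beltrami := ((N⁻¹ : ℝ) : ℂ) • hσL.toLp σ
  have hνae : ∀ᵐ w, ν w = ((N⁻¹ : ℝ) : ℂ) * σ w := by
    filter_upwards [Lp.coeFn_smul ((N⁻¹ : ℝ) : ℂ) (hσL.toLp σ), hσL.coeFn_toLp] with w h1 h2
    rw [h1, Pi.smul_apply, h2, smul_eq_mul]
  have hνnorm : ‖ν‖ ≤ N⁻¹ := by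
    refine Beltrami.norm_le_of_ae (by positivity) ?_
    filter_upwards [hνae] with w hw
    rw [hw, norm_mul, Complex.norm_real, Real.norm_of_nonneg (by positivity)]
    exact mul_le_of_le_one_right (by positivity) (hσ1 w)
  have hνequiv : InfEquiv z ν μ := by
    refine (infEquiv_iff hz0 hz1 hz).2 fun k => ?_
    have hk : ∀ w, phi z k w = comb z (Pi.single k 1) w := by
      intro w
      simp [comb, Pi.single_apply]
    simp_rw [hk]
    rw [← hℓ]
    have : ∫ w, ν w * comb z (Pi.single k 1) w =
        ∫ w, ((N⁻¹ : ℝ) : ℂ) * (σ w * comb z (Pi.single k 1) w) := by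
      refine integral_congr_ae ?_
      filter_upwards [hνae] with w hw
      rw [hw, mul_assoc]
    have hN' : (N : ℂ) ≠ 0 := by exact_mod_cast hNpos.ne'
    rw [this, integral_const_mul, hσall]
    push_cast
    field_simp
  have hpair : ∀ β : Beltrami, InfEquiv z β μ → ∫ w, β w * f w = 1 := by
    intro β hβ
    rw [hfdef, integral_mul_comb hz0 hz1]
    have hk := (infEquiv_iff hz0 hz1 hz).1 hβ
    simp only [hk]
    rw [← integral_mul_comb hz0 hz1, ← hℓ]
    exact hx1
  have hlow : ∀ β : Beltrami, InfEquiv z β μ → N⁻¹ ≤ ‖β‖ := by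
    intro β hβ
    have := β.norm_integral_mul_le hf
    rw [hpair β hβ, norm_one] at this
    rwa [inv_le_iff_one_le_mul₀ hNpos]
  refine ⟨ν, ⟨hνequiv, fun β hβ => hνnorm.trans (hlow β hβ)⟩, fun β hβ => ?_⟩
  have hβN : ‖β‖ ≤ N⁻¹ := (hβ.2 ν hνequiv).trans hνnorm
  -- Equality holds in the pairing with f, so β f = N⁻¹|f| almost everywhere; since f ≠ 0 almost
  -- everywhere, β is determined.
  have heq := Beltrami.mul_eq_of_integral_eq hf hβN (by
    rw [hpair β hβ.1, ← hN, inv_mul_cancel₀ hNpos.ne', Complex.ofReal_one])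
  refine Lp.ext ?_
  filter_upwards [heq, hνae, hf0] with w h1 h2 h3
  rw [h2]
  refine mul_right_cancel₀ h3 ?_
  rw [h1, mul_assoc, hσf]
  push_cast; ring

end Inext

/-! ### Discretization: face moments against L¹ norms. -/

namespace Inext

open Filter Topology

/-! ### Integrals over the faces -/

namespace Triangulation

variable (Δ : Triangulation)

lemma sum_indicator_ae_eq (g : ℂ → ℝ) :
    ∀ᵐ w, ∑ s : Δ.Face, (Δ.region s).indicator g w = g w := by
  filter_upwards [Δ.ae_existsUnique_face] with w hw
  obtain ⟨s, hs, huniq⟩ := hw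
  rw [Finset.sum_eq_single s, Set.indicator_of_mem hs]
  · intro t _ hts
    exact Set.indicator_of_notMem (fun ht => hts (huniq t ht)) _
  · simp

lemma sum_setIntegral_region {g : ℂ → ℝ} (hg : Integrable g) :
    ∑ s : Δ.Face, ∫ w in Δ.region s, g w = ∫ w, g w := by
  simp_rw [← integral_indicator (Δ.measurableSet_region _)]
  rw [← integral_finsetSum _ fun s _ => hg.indicator (Δ.measurableSet_region s)]
  exact integral_congr_ae (Δ.sum_indicator_ae_eq g)

lemma norm_pwConst_le (v : Δ.Face → ℂ) : ‖Δ.pwConst v‖ ≤ ‖v‖ := by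
  refine Beltrami.norm_le_of_ae (norm_nonneg v) ?_
  filter_upwards [(Δ.memLp_pwFun v).coeFn_toLp, Δ.ae_existsUnique_face] with w hw hu
  obtain ⟨s, hs, huniq⟩ := hu
  have : Δ.pwConst v w = v s := by
    refine hw.trans ?_
    rw [pwFun, Finset.sum_eq_single s, Set.indicator_of_mem hs]
    · intro t _ hts
      exact Set.indicator_of_notMem (fun ht => hts (huniq t ht)) _
    · simp
  rw [this]
  exact norm_le_pi_norm v s

lemma integral_pwConst_mul (v : Δ.Face → ℂ) {φ : ℂ → ℂ} (hφ : Integrable φ) :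
    ∫ w, Δ.pwConst v w * φ w = ∑ s : Δ.Face, (∫ w in Δ.region s, φ w) * v s := by
  have h1 : ∀ᵐ w, Δ.pwConst v w * φ w =
      ∑ s : Δ.Face, (Δ.region s).indicator (fun w => φ w * v s) w := by
    filter_upwards [(Δ.memLp_pwFun v).coeFn_toLp] with w hw
    have : Δ.pwConst v w = Δ.pwFun v w := hw
    rw [this, pwFun, Finset.sum_mul]
    refine Finset.sum_congr rfl fun s _ => ?_
    by_cases hs : w ∈ Δ.region s
    · rw [Set.indicator_of_mem hs, Set.indicator_of_mem hs, mul_comm]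
    · rw [Set.indicator_of_notMem hs, Set.indicator_of_notMem hs, zero_mul]
  rw [integral_congr_ae h1, integral_finsetSum _ fun s _ =>
    (hφ.mul_const (v s)).indicator (Δ.measurableSet_region s)]
  refine Finset.sum_congr rfl fun s _ => ?_
  rw [integral_indicator (Δ.measurableSet_region s), integral_mul_const]

/-- A function that is nearly constant on a set has little cancellation there. -/
lemma setIntegral_norm_le {f : ℂ → ℂ} (hf : Integrable f) (s : Δ.Face) (κ : ℂ)
    (hκ : OnePoint.infty ∈ s.1 → κ = 0) :
    ∫ w in Δ.region s, ‖f w‖ ≤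
      ‖∫ w in Δ.region s, f w‖ + 2 * ∫ w in Δ.region s, ‖f w - κ‖ := by
  -- On an unbounded face only κ = 0 is allowed, and the error term alone already dominates the left
  -- side.
  by_cases hi : OnePoint.infty ∈ s.1
  · rw [hκ hi]
    simp only [sub_zero]
    have h0 : 0 ≤ ∫ w in Δ.region s, ‖f w‖ := integral_nonneg fun w => norm_nonneg _
    linarith [norm_nonneg (∫ w in Δ.region s, f w)]
  · have hc : IntegrableOn (fun _ : ℂ => κ) (Δ.region s) :=
      integrableOn_const (Δ.volume_region_lt_top s hi).ne
    have hfs : IntegrableOn f (Δ.region s) := hf.integrableOn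
    have hd : IntegrableOn (fun w => f w - κ) (Δ.region s) := hfs.sub hc
    have h1 : ∫ w in Δ.region s, ‖f w‖ ≤
        (∫ w in Δ.region s, ‖κ‖) + ∫ w in Δ.region s, ‖f w - κ‖ := by
      rw [← integral_add hc.norm hd.norm]
      refine integral_mono hfs.norm (hc.norm.add hd.norm) fun w => ?_
      have := norm_add_le κ (f w - κ)
      rwa [add_sub_cancel] at this
    have h2 : ∫ w in Δ.region s, ‖κ‖ = ‖∫ w in Δ.region s, κ‖ := by
      rw [setIntegral_const, setIntegral_const, norm_smul,
        Real.norm_of_nonneg measureReal_nonneg, smul_eq_mul]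
    have h3 : ‖∫ w in Δ.region s, κ‖ ≤
        ‖∫ w in Δ.region s, f w‖ + ∫ w in Δ.region s, ‖f w - κ‖ := by
      have : ∫ w in Δ.region s, κ = (∫ w in Δ.region s, f w) - ∫ w in Δ.region s, (f w - κ) := by
        rw [integral_sub hfs hc]; ring
      rw [this]
      exact (norm_sub_le _ _).trans (add_le_add_right (norm_integral_le_integral_norm _) _)
    linarith

end Triangulation

/-! ### The discretization error -/

variable {m : ℕ} {z : Fin m → ℂ}

section

variable (hz0 : ∀ i, z i ≠ 0) (hz1 : ∀ i, z i ≠ 1)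
include hz0 hz1

/-- Approximation of `φ_k` in `L¹` by functions that are constant on each face. -/
lemma exists_sum_setIntegral_phi_sub_le (k : Fin m) : ∃ C : ℝ, 0 ≤ C ∧
    ∀ (Δ : Triangulation) (ε ρ R : ℝ) (N : ℕ), 0 < ρ → ε ≤ ρ → Δ.MeshLE ε →
      2 * (1 + ‖z k‖) ≤ R → Δ.ContainsOuterPolygon N (2 * R) →
      ∃ κ : Δ.Face → ℂ, (∀ s : Δ.Face, OnePoint.infty ∈ s.1 → κ s = 0) ∧
        ∑ s : Δ.Face, ∫ w in Δ.region s, ‖phi z k w - κ s‖ ≤ C * (ε / ρ + ρ + 1 / R) := by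
  classical
  obtain ⟨C₁, hC₁, hball⟩ := exists_setIntegral_ball_base_le (hz0 k) (hz1 k)
  obtain ⟨C₂, hC₂, hext⟩ := exists_setIntegral_compl_ball_base_le (hz0 k) (hz1 k)
  have heta := eta_pos hz0 hz1 k
  have hint := integrable_phi hz0 hz1 k
  set e := eta z k with he
  refine ⟨7 + 6 * (e * C₁) + e * C₂, by positivity, fun Δ ε ρ R N hρ hερ hmesh hR hpoly => ?_⟩
  have hR0 : 0 < R := by linarith [norm_nonneg (z k)]
  have hε0 : 0 ≤ ε := by
    obtain ⟨s, hs, w, hw⟩ : ∃ s ∈ Δ.faces, ∃ a : ℂ, (a : OnePoint ℂ) ∈ s := by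
      obtain ⟨s, hs, p, hp, -⟩ := Δ.cover 0
      obtain ⟨a, ha⟩ := convexHull_nonempty_iff.1 ⟨p, hp⟩
      exact ⟨s, hs, a, ha⟩
    simpa using hmesh s hs w w hw hw
  let P : Finset ℂ := {0, 1, z k}
  have hPmem : ∀ p : ℂ, p ∈ ({0, 1, z k} : Set ℂ) ↔ p ∈ P := fun p => by simp [P]
  have hPcard : (P.card : ℝ) ≤ 3 := by exact_mod_cast Finset.card_le_three
  -- Bounded faces at distance at least ρ from the poles. There κ is a sample value of φ_k; on all
  -- other faces it is 0 and the whole mass counts as error.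
  let good : Δ.Face → Prop := fun s => OnePoint.infty ∉ s.1 ∧
    ∀ w ∈ Δ.region s, ∀ p ∈ ({0, 1, z k} : Set ℂ), ρ ≤ dist w p
  let pt : Δ.Face → ℂ := fun s => (Δ.region_nonempty s).some
  have hpt : ∀ s, pt s ∈ Δ.region s := fun s => (Δ.region_nonempty s).some_mem
  let κ : Δ.Face → ℂ := fun s => if good s then phi z k (pt s) else 0
  have hκ : ∀ s : Δ.Face, OnePoint.infty ∈ s.1 → κ s = 0 := fun s hs =>
    if_neg fun h => h.1 hs
  -- One majorant for all faces. A bounded bad face comes within ρ of a pole and has diameter at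
  -- most ε ≤ ρ, so it lies in the disk of radius 2ρ about that pole; an unbounded face lies outside
  -- the disk of radius R.
  let g : ℂ → ℝ := fun w => 7 * (ε / ρ) * ‖phi z k w‖
    + (∑ p ∈ P, (Metric.ball p (2 * ρ)).indicator (fun w => ‖phi z k w‖) w
      + (Metric.ball 0 R)ᶜ.indicator (fun w => ‖phi z k w‖) w)
  have hi1 : Integrable fun w => 7 * (ε / ρ) * ‖phi z k w‖ := hint.norm.const_mul _
  have hi2 : ∀ p ∈ P, Integrable ((Metric.ball p (2 * ρ)).indicator fun w => ‖phi z k w‖) :=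
    fun p _ => hint.norm.indicator measurableSet_ball
  have hi3 : Integrable ((Metric.ball (0 : ℂ) R)ᶜ.indicator fun w => ‖phi z k w‖) :=
    hint.norm.indicator measurableSet_ball.compl
  have hi23 := (integrable_finsetSum P hi2).add hi3
  have hg : Integrable g := hi1.add hi23
  have hnn : ∀ (S : Set ℂ) (w : ℂ), 0 ≤ S.indicator (fun w => ‖phi z k w‖) w := fun S w =>
    Set.indicator_nonneg (fun _ _ => norm_nonneg _) w
  have hpw : ∀ s, ∀ w ∈ Δ.region s, ‖phi z k w - κ s‖ ≤ g w := by
    intro s w hw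
    have hs1 : 0 ≤ 7 * (ε / ρ) * ‖phi z k w‖ := by positivity
    have hs2 : 0 ≤ ∑ p ∈ P, (Metric.ball p (2 * ρ)).indicator (fun w => ‖phi z k w‖) w :=
      Finset.sum_nonneg fun p _ => hnn _ _
    have hs3 := hnn (Metric.ball (0 : ℂ) R)ᶜ w
    by_cases hgood : good s
    · have hκs : κ s = phi z k (pt s) := if_pos hgood
      have hd : dist w (pt s) ≤ ε := Δ.dist_le_of_mem_cell hmesh s.2 hgood.1 hw (hpt s)
      have hb := norm_base_sub_le hρ hερ hd (hgood.2 _ (hpt s)) (hgood.2 w hw)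
      have : ‖phi z k w - κ s‖ ≤ 7 * (ε / ρ) * ‖phi z k w‖ := by
        rw [hκs, norm_phi hz0 hz1, phi_eq, phi_eq, ← mul_sub, norm_mul, Complex.norm_real,
          Real.norm_of_nonneg heta.le]
        calc e * _ ≤ e * _ := mul_le_mul_of_nonneg_left hb heta.le
          _ = _ := by ring
      simp only [g]
      linarith
    · have hκs : κ s = 0 := if_neg hgood
      rw [hκs, sub_zero]
      by_cases hinf : OnePoint.infty ∈ s.1
      · have hw' : R ≤ ‖w‖ := by
          have := Δ.half_radius_le_norm hpoly s.2 hinf hw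
          linarith
        have : (Metric.ball (0 : ℂ) R)ᶜ.indicator (fun w => ‖phi z k w‖) w = ‖phi z k w‖ :=
          Set.indicator_of_mem (by simpa using hw') _
        simp only [g]
        linarith
      · obtain ⟨w₀, hw₀, p, hp, hlt⟩ : ∃ w₀ ∈ Δ.region s, ∃ p ∈ ({0, 1, z k} : Set ℂ),
            dist w₀ p < ρ := by
          by_contra! hcon
          exact hgood ⟨hinf, hcon⟩
        have hd : dist w w₀ ≤ ε := Δ.dist_le_of_mem_cell hmesh s.2 hinf hw hw₀
        have hwp : w ∈ Metric.ball p (2 * ρ) := by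
          rw [Metric.mem_ball]
          linarith [dist_triangle w w₀ p]
        have h1 : (Metric.ball p (2 * ρ)).indicator (fun w => ‖phi z k w‖) w = ‖phi z k w‖ :=
          Set.indicator_of_mem hwp _
        have h2 := Finset.single_le_sum (f := fun p =>
          (Metric.ball p (2 * ρ)).indicator (fun w => ‖phi z k w‖) w)
          (fun p _ => hnn _ _) ((hPmem p).1 hp)
        simp only [g]
        linarith
  refine ⟨κ, hκ, ?_⟩
  have hsum : ∑ s : Δ.Face, ∫ w in Δ.region s, ‖phi z k w - κ s‖ ≤ ∫ w, g w := by
    rw [← Δ.sum_setIntegral_region hg]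
    refine Finset.sum_le_sum fun s _ => ?_
    refine integral_mono_of_nonneg (Eventually.of_forall fun w => norm_nonneg _)
      hg.integrableOn ?_
    exact (ae_restrict_iff' (Δ.measurableSet_region s)).2 (Eventually.of_forall (hpw s))
  refine hsum.trans ?_
  have hb : ∀ p ∈ P, ∫ w, (Metric.ball p (2 * ρ)).indicator (fun w => ‖phi z k w‖) w
      ≤ e * (C₁ * (2 * ρ)) := by
    intro p _
    rw [integral_indicator measurableSet_ball]
    simp_rw [norm_phi hz0 hz1]
    rw [integral_const_mul]
    exact mul_le_mul_of_nonneg_left (hball p (2 * ρ) (by positivity)) heta.le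
  have hx : ∫ w, (Metric.ball (0 : ℂ) R)ᶜ.indicator (fun w => ‖phi z k w‖) w ≤ e * (C₂ / R) := by
    rw [integral_indicator measurableSet_ball.compl]
    simp_rw [norm_phi hz0 hz1]
    rw [integral_const_mul]
    exact mul_le_mul_of_nonneg_left (hext R hR) heta.le
  have hgint : ∫ w, g w = 7 * (ε / ρ) +
      ((∑ p ∈ P, ∫ w, (Metric.ball p (2 * ρ)).indicator (fun w => ‖phi z k w‖) w)
      + ∫ w, (Metric.ball (0 : ℂ) R)ᶜ.indicator (fun w => ‖phi z k w‖) w) := by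
    have e1 : ∫ w, g w = (∫ w, 7 * (ε / ρ) * ‖phi z k w‖) + ∫ w,
        (∑ p ∈ P, (Metric.ball p (2 * ρ)).indicator (fun w => ‖phi z k w‖) w
          + (Metric.ball 0 R)ᶜ.indicator (fun w => ‖phi z k w‖) w) := integral_add hi1 hi23
    rw [e1, integral_const_mul, integral_norm_phi hz0 hz1, mul_one,
      integral_add (integrable_finsetSum P hi2) hi3, integral_finsetSum P hi2]
  have hbs : ∑ p ∈ P, ∫ w, (Metric.ball p (2 * ρ)).indicator (fun w => ‖phi z k w‖) w
      ≤ 3 * (e * (C₁ * (2 * ρ))) := by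
    refine (Finset.sum_le_card_nsmul P _ _ hb).trans ?_
    rw [nsmul_eq_mul]
    gcongr
  rw [hgint]
  have hER : 0 ≤ ε / ρ := by positivity
  have hRi : 0 ≤ 1 / R := by positivity
  have hA : 0 ≤ e * C₁ := by positivity
  have hB : 0 ≤ e * C₂ := by positivity
  have e2 : e * (C₂ / R) = e * C₂ * (1 / R) := by ring
  nlinarith [mul_nonneg hA hER, mul_nonneg hA hRi, mul_nonneg hB hER, mul_nonneg hB hρ.le]

/-- The moments over the faces of a fine triangulation nearly exhaust the norm. -/
theorem exists_norm_le_add_sum_norm_setIntegral (hz : Function.Injective z) : ∃ C : ℝ, 0 ≤ C ∧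
    ∀ (Δ : Triangulation) (ε ρ R : ℝ) (N : ℕ), 0 < ρ → ε ≤ ρ → Δ.MeshLE ε →
      (∀ k, 2 * (1 + ‖z k‖) ≤ R) → Δ.ContainsOuterPolygon N (2 * R) →
      ∀ x : Fin m → ℂ, ∫ w, ‖comb z x w‖ ≤ (∑ s : Δ.Face, ‖∫ w in Δ.region s, comb z x w‖)
        + C * (ε / ρ + ρ + 1 / R) * ∫ w, ‖comb z x w‖ := by
  choose C hC hosc using fun k => exists_sum_setIntegral_phi_sub_le hz0 hz1 k
  obtain ⟨M, hM, hMx⟩ := exists_sum_norm_le hz0 hz1 hz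
  have hCs : 0 ≤ ∑ k, C k := Finset.sum_nonneg fun k _ => hC k
  refine ⟨2 * (∑ k, C k) * M, by positivity,
    fun Δ ε ρ R N hρ hερ hmesh hR hpoly x => ?_⟩
  have hR0 : 0 < R := by
    obtain ⟨θ, ⟨-, hr, -⟩, -⟩ := hpoly
    linarith
  choose κ hκ hκsum using fun k => hosc k Δ ε ρ R N hρ hερ hmesh (hR k) hpoly
  set τ := ε / ρ + ρ + 1 / R with hτ
  have hε0 : 0 ≤ ε := by
    obtain ⟨s, hs, p, hp, -⟩ := Δ.cover 0
    obtain ⟨a, ha⟩ := convexHull_nonempty_iff.1 ⟨p, hp⟩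
    simpa using hmesh s hs a a ha ha
  have hτ0 : 0 ≤ τ := by positivity
  have hcomb := integrable_comb hz0 hz1 x
  have hface : ∀ s : Δ.Face, ∫ w in Δ.region s, ‖comb z x w‖ ≤
      ‖∫ w in Δ.region s, comb z x w‖
        + 2 * ∑ k, ‖x k‖ * ∫ w in Δ.region s, ‖phi z k w - κ k s‖ := by
    intro s
    refine (Δ.setIntegral_norm_le hcomb s (∑ k, x k * κ k s) fun hi => ?_).trans ?_
    · exact Finset.sum_eq_zero fun k _ => by rw [hκ k s hi, mul_zero]
    · have hint : ∀ k, IntegrableOn (fun w => ‖phi z k w - κ k s‖) (Δ.region s) := by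
        intro k
        by_cases hi : OnePoint.infty ∈ s.1
        · rw [hκ k s hi]
          simpa using (integrable_phi hz0 hz1 k).norm.integrableOn
        · exact ((integrable_phi hz0 hz1 k).integrableOn.sub
            (integrableOn_const (Δ.volume_region_lt_top s hi).ne)).norm
      gcongr
      simp_rw [← integral_const_mul]
      rw [← integral_finsetSum _ fun k _ => (hint k).const_mul _]
      refine integral_mono_of_nonneg (Eventually.of_forall fun w => norm_nonneg _)
        (integrable_finsetSum _ fun k _ => (hint k).const_mul _)
        (Eventually.of_forall fun w => ?_)
      have : comb z x w - ∑ k, x k * κ k s = ∑ k, x k * (phi z k w - κ k s) := by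
        simp_rw [comb, mul_sub, Finset.sum_sub_distrib]
      simp only [this]
      refine (norm_sum_le _ _).trans (le_of_eq ?_)
      simp_rw [norm_mul]
  calc ∫ w, ‖comb z x w‖ = ∑ s : Δ.Face, ∫ w in Δ.region s, ‖comb z x w‖ :=
        (Δ.sum_setIntegral_region hcomb.norm).symm
    _ ≤ ∑ s : Δ.Face, (‖∫ w in Δ.region s, comb z x w‖
        + 2 * ∑ k, ‖x k‖ * ∫ w in Δ.region s, ‖phi z k w - κ k s‖) :=
        Finset.sum_le_sum fun s _ => hface s
    _ = (∑ s : Δ.Face, ‖∫ w in Δ.region s, comb z x w‖)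
        + 2 * ∑ k, ‖x k‖ * ∑ s : Δ.Face, ∫ w in Δ.region s, ‖phi z k w - κ k s‖ := by
        rw [Finset.sum_add_distrib, ← Finset.mul_sum, Finset.sum_comm]
        simp_rw [Finset.mul_sum]
    -- After exchanging the sums, only the total oscillation of each φ_k enters; Σ|x_k| is then
    -- absorbed into the norm by equivalence of norms, uniformly in Δ.
    _ ≤ (∑ s : Δ.Face, ‖∫ w in Δ.region s, comb z x w‖)
        + 2 * ∑ k, ‖x k‖ * ((∑ j, C j) * τ) := by
        gcongr with k
        refine (hκsum k).trans ?_
        gcongr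
        exact Finset.single_le_sum (fun j _ => hC j) (Finset.mem_univ k)
    _ = (∑ s : Δ.Face, ‖∫ w in Δ.region s, comb z x w‖)
        + 2 * ((∑ k, ‖x k‖) * ((∑ j, C j) * τ)) := by rw [← Finset.sum_mul]
    _ ≤ (∑ s : Δ.Face, ‖∫ w in Δ.region s, comb z x w‖)
        + 2 * ((M * ∫ w, ‖comb z x w‖) * ((∑ j, C j) * τ)) := by
        gcongr
        exact hMx x
    _ = _ := by ring

end

end Inext

/-! ### The finite moment problem and its quadratic program. -/

namespace Inext

open Filter Topology

/-! ### Duality for the moment problem on finitely many faces -/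

/-- A bound on the dual problem gives a solution of the finite moment problem. -/
lemma exists_mulVec_eq_of_dual_bound {ι τ : Type*} [Fintype ι] [Fintype τ] (A : Matrix ι τ ℂ)
    (a : τ → ℂ) {C : ℝ} (hC : 0 ≤ C)
    (h : ∀ x : ι → ℂ, ‖∑ k, x k * A.mulVec a k‖ ≤ C * ∑ s, ‖∑ k, x k * A k s‖) :
    ∃ v : τ → ℂ, A.mulVec v = A.mulVec a ∧ ∀ s, ‖v s‖ ≤ C := by
  classical
  let row : ι → PiLp 1 fun _ : τ => ℂ := fun k => WithLp.toLp 1 (A k)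
  let p : Submodule ℂ (PiLp 1 fun _ : τ => ℂ) := Submodule.span ℂ (Set.range row)
  -- On the row span in ℓ¹ the hypothesis bounds this functional by C. A Hahn–Banach extension keeps
  -- the moments, and its values on the unit vectors are the required v, bounded by C.
  let G : (PiLp 1 fun _ : τ => ℂ) →ₗ[ℂ] ℂ :=
    { toFun := fun y => ∑ s, y s * a s
      map_add' := fun y y' => by simp [add_mul, Finset.sum_add_distrib]
      map_smul' := fun c y => by simp [Finset.mul_sum, mul_assoc] }
  have hbound : ∀ y : p, ‖(G.comp p.subtype) y‖ ≤ C * ‖y‖ := by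
    rintro ⟨y, hy⟩
    obtain ⟨x, rfl⟩ := (Submodule.mem_span_range_iff_exists_fun ℂ).1 hy
    have h1 := h x
    have hrow : ∀ s, (∑ k, x k • row k) s = ∑ k, x k * A k s := by
      intro s
      simp [row]
    have hG : G (∑ k, x k • row k) = ∑ k, x k * A.mulVec a k := by
      rw [map_sum]
      refine Finset.sum_congr rfl fun k _ => ?_
      rw [map_smul, smul_eq_mul]
      rfl
    have hn : ‖∑ k, x k • row k‖ = ∑ s, ‖∑ k, x k * A k s‖ := by
      rw [PiLp.norm_eq_of_L1]
      simp_rw [hrow]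
    calc ‖G (∑ k, x k • row k)‖ ≤ C * ∑ s, ‖∑ k, x k * A k s‖ := by rw [hG]; exact h1
      _ = _ := by rw [← hn]; rfl
  obtain ⟨g, hg, hgn⟩ := exists_extension_norm_eq p ((G.comp p.subtype).mkContinuous C hbound)
  have hgC : ‖g‖ ≤ C := by
    rw [hgn]; exact LinearMap.mkContinuous_norm_le _ hC _
  refine ⟨fun s => g (PiLp.single 1 s 1), ?_, fun s => ?_⟩
  · ext k
    have h1 : g (row k) = G (row k) := hg ⟨row k, Submodule.subset_span ⟨k, rfl⟩⟩
    have h2 : row k = ∑ s, A k s • PiLp.single 1 s (1 : ℂ) := by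
      ext t
      simp [row, Pi.single_apply]
    have h3 : A.mulVec a k = G (row k) := rfl
    rw [h3, ← h1]
    conv_rhs => rw [h2, map_sum]
    simp only [map_smul, smul_eq_mul]
    rfl
  · refine (g.le_of_opNorm_le hgC _).trans ?_
    rw [PiLp.norm_single, norm_one, mul_one]

/-! ### The discrete program -/

variable {m : ℕ} {z : Fin m → ℂ}

/-- The complex face values encoded by a vector of unknowns. -/
def faceValues {Δ : Triangulation} (β : Var Δ → ℝ) (s : Δ.Face) : ℂ :=
  ⟨β (Sum.inl s), β (Sum.inr (Sum.inl s))⟩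

lemma discreteProgram_objective (Δ : Triangulation) (a : Δ.Face → ℂ) (β : Var Δ → ℝ) :
    (discreteProgram z Δ a).objective β = β (Sum.inr (Sum.inr ())) := by
  simp [QCQP.objective, discreteProgram, dotProduct, Fintype.sum_sum_type]

/-- The two real blocks are the real and imaginary parts of one complex system, and ζ bounds the
squared moduli of all face values. -/
lemma discreteProgram_feasible_iff (Δ : Triangulation) (a : Δ.Face → ℂ) (β : Var Δ → ℝ) :
    (discreteProgram z Δ a).Feasible β ↔
      (constraintMatrix z Δ).mulVec (faceValues β) = (constraintMatrix z Δ).mulVec a ∧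
      ∀ s, ‖faceValues β s‖ ^ 2 ≤ β (Sum.inr (Sum.inr ())) := by
  classical
  unfold QCQP.Feasible
  refine and_congr ?_ (forall_congr' fun s => ?_)
  · rw [funext_iff, Sum.forall, funext_iff, ← forall_and]
    refine forall_congr' fun k => ?_
    rw [Complex.ext_iff]
    refine and_congr ?_ ?_
    · simp [discreteProgram, Matrix.mulVec, dotProduct, Fintype.sum_sum_type, faceValues,
        Finset.sum_add_distrib, sub_eq_add_neg]
    · simp [discreteProgram, Matrix.mulVec, dotProduct, Fintype.sum_sum_type, faceValues,
        Finset.sum_add_distrib, add_comm]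
  · rw [← Complex.normSq_eq_norm_sq, Complex.normSq_apply]
    simp [discreteProgram, Matrix.mulVec_diagonal, dotProduct, Fintype.sum_sum_type, faceValues,
      Pi.single_apply]

lemma discreteProgram_isConvex (Δ : Triangulation) (a : Δ.Face → ℂ) :
    (discreteProgram z Δ a).IsConvex := by
  classical
  refine ⟨Matrix.PosSemidef.zero, fun s => ?_⟩
  refine Matrix.PosSemidef.diagonal fun i => ?_
  rcases i with t | t | t
  · by_cases h : t = s <;> simp [h]
  · by_cases h : t = s <;> simp [h]
  · simp

/-- INEXT returns the solutions of least norm of the finite moment problem. -/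
lemma inextReturns_iff (Δ : Triangulation) (a v : Δ.Face → ℂ) :
    InextReturns z Δ a v ↔ (constraintMatrix z Δ).mulVec v = (constraintMatrix z Δ).mulVec a ∧
      ∀ u : Δ.Face → ℂ, (constraintMatrix z Δ).mulVec u = (constraintMatrix z Δ).mulVec a →
        ‖v‖ ≤ ‖u‖ := by
  -- For given face values the least admissible ζ is the square of their sup norm.
  let enc : (Δ.Face → ℂ) → Var Δ → ℝ := fun u =>
    Sum.elim (fun s => (u s).re) (Sum.elim (fun s => (u s).im) fun _ => ‖u‖ ^ 2)
  have henc : ∀ u, faceValues (enc u) = u := fun u => rfl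
  have hfeas : ∀ u, (constraintMatrix z Δ).mulVec u = (constraintMatrix z Δ).mulVec a →
      (discreteProgram z Δ a).Feasible (enc u) := by
    intro u hu
    refine (discreteProgram_feasible_iff Δ a _).2 ⟨by rw [henc]; exact hu, fun s => ?_⟩
    rw [henc]
    exact pow_le_pow_left₀ (norm_nonneg _) (norm_le_pi_norm u s) 2
  have hnorm : ∀ β, (discreteProgram z Δ a).Feasible β →
      ‖faceValues β‖ ^ 2 ≤ β (Sum.inr (Sum.inr ())) := by
    intro β hβ
    have h := ((discreteProgram_feasible_iff Δ a β).1 hβ).2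
    have hζ : 0 ≤ β (Sum.inr (Sum.inr ())) :=
      (sq_nonneg _).trans (h (Classical.arbitrary Δ.Face))
    rw [← Real.sq_sqrt hζ]
    refine pow_le_pow_left₀ (norm_nonneg _) ?_ 2
    exact (pi_norm_le_iff_of_nonneg (Real.sqrt_nonneg _)).2 fun s => Real.le_sqrt_of_sq_le (h s)
  constructor
  · rintro ⟨β, ⟨hβ, hopt⟩, hv⟩
    have hvβ : v = faceValues β := funext hv
    subst hvβ
    refine ⟨((discreteProgram_feasible_iff Δ a β).1 hβ).1, fun u hu => ?_⟩
    have h1 := hopt _ (hfeas u hu)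
    rw [discreteProgram_objective, discreteProgram_objective] at h1
    exact (pow_le_pow_iff_left₀ (norm_nonneg _) (norm_nonneg _) two_ne_zero).1
      ((hnorm β hβ).trans h1)
  · rintro ⟨hv, hmin⟩
    refine ⟨enc v, ⟨hfeas v hv, fun β' hβ' => ?_⟩, fun s => rfl⟩
    rw [discreteProgram_objective, discreteProgram_objective]
    refine le_trans ?_ (hnorm β' hβ')
    exact pow_le_pow_left₀ (norm_nonneg _)
      (hmin _ ((discreteProgram_feasible_iff Δ a β').1 hβ').1) 2

/-- The solutions form a closed set containing a in a finite-dimensional space; a point nearest to 0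
in the sup norm is optimal. -/
lemma exists_inextReturns (Δ : Triangulation) (a : Δ.Face → ℂ) :
    ∃ v, InextReturns z Δ a v := by
  have hcl : IsClosed {u : Δ.Face → ℂ |
      (constraintMatrix z Δ).mulVec u = (constraintMatrix z Δ).mulVec a} :=
    isClosed_eq (Continuous.matrix_mulVec continuous_const continuous_id) continuous_const
  obtain ⟨v, hv, hd⟩ := hcl.exists_infDist_eq_dist ⟨a, rfl⟩ 0
  refine ⟨v, (inextReturns_iff Δ a v).2 ⟨hv, fun u hu => ?_⟩⟩
  have := Metric.infDist_le_dist_of_mem (x := 0) (s := {u : Δ.Face → ℂ |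
      (constraintMatrix z Δ).mulVec u = (constraintMatrix z Δ).mulVec a}) hu
  rwa [hd, dist_zero_left, dist_zero_left] at this

section

variable (hz0 : ∀ i, z i ≠ 0) (hz1 : ∀ i, z i ≠ 1)
include hz0 hz1

lemma integral_pwConst_mul_phi (Δ : Triangulation) (v : Δ.Face → ℂ) (k : Fin m) :
    ∫ w, Δ.pwConst v w * phi z k w = (constraintMatrix z Δ).mulVec v k :=
  Δ.integral_pwConst_mul v (integrable_phi hz0 hz1 k)

lemma setIntegral_comb (Δ : Triangulation) (x : Fin m → ℂ) (s : Δ.Face) :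
    ∫ w in Δ.region s, comb z x w = ∑ k, x k * constraintMatrix z Δ k s := by
  simp_rw [comb]
  rw [integral_finsetSum _ fun k _ => ((integrable_phi hz0 hz1 k).const_mul _).integrableOn]
  refine Finset.sum_congr rfl fun k _ => ?_
  rw [integral_const_mul]
  rfl

/-- If the moments over the faces nearly exhaust the norm, then the output of INEXT is nearly
extremal. -/
lemma norm_pwConst_le_of_inextReturns {Δ : Triangulation} {a v : Δ.Face → ℂ}
    (hv : InextReturns z Δ a v) (hz : Function.Injective z) {ν : Beltrami}
    (hν : InfEquiv z ν (Δ.pwConst a)) {C : ℝ} (hC : 0 ≤ C)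
    (h : ∀ x : Fin m → ℂ,
      ∫ w, ‖comb z x w‖ ≤ C * ∑ s : Δ.Face, ‖∫ w in Δ.region s, comb z x w‖) :
    ‖Δ.pwConst v‖ ≤ C * ‖ν‖ := by
  -- The moments of a are those of ν, so the dual functional is ∫νφ, at most ‖ν‖ ∫|φ| and hence at
  -- most C‖ν‖ times the sum over the faces.
  obtain ⟨u, hu, hun⟩ := exists_mulVec_eq_of_dual_bound (constraintMatrix z Δ) a
    (C := C * ‖ν‖) (by positivity) fun x => by
      have h1 := (infEquiv_iff hz0 hz1 hz).1 hν
      simp_rw [← integral_pwConst_mul_phi hz0 hz1, ← h1, ← setIntegral_comb hz0 hz1]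
      rw [← integral_mul_comb hz0 hz1]
      refine (ν.norm_integral_mul_le (integrable_comb hz0 hz1 x)).trans ?_
      calc ‖ν‖ * ∫ w, ‖comb z x w‖
          ≤ ‖ν‖ * (C * ∑ s : Δ.Face, ‖∫ w in Δ.region s, comb z x w‖) := by gcongr; exact h x
        _ = _ := by ring
  refine (Δ.norm_pwConst_le v).trans ((((inextReturns_iff Δ a v).1 hv).2 u hu).trans ?_)
  exact (pi_norm_le_iff_of_nonneg (by positivity)).2 hun

end

end Inext

/-! ### Choice of the constants and conclusion. -/

theorem mainTheorem5 (n : ℕ) (hn : 3 ≤ n) (z : Fin (n - 3) → ℂ)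
    (hz : Function.Injective z) (hz0 : ∀ i, z i ≠ 0) (hz1 : ∀ i, z i ≠ 1) :
    ∃ c : ℝ, 0 < c ∧ ∀ (δ ε : ℝ) (Δ : Inext.Triangulation) (a : Δ.Face → ℂ),
      0 < δ → δ < 1 → ε ≤ c * δ ^ (6 * n - 2) → Δ.IsCanonical n z c δ ε →
      ‖Δ.pwConst a‖ < 1 →
      (Inext.discreteProgram z Δ a).IsConvex ∧
      (∃! ν : Inext.Beltrami, Inext.IsInfExtremal z (Δ.pwConst a) ν) ∧
      (∃ v : Δ.Face → ℂ, Inext.InextReturns z Δ a v) ∧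
      ∀ v : Δ.Face → ℂ, Inext.InextReturns z Δ a v →
        Inext.InfEquiv z (Δ.pwConst v) (Δ.pwConst a) ∧
        ∀ ν : Inext.Beltrami, Inext.IsInfExtremal z (Δ.pwConst a) ν →
          (ν ≠ 0 → ‖Δ.pwConst v‖ - ‖ν‖ < ‖ν‖ * δ) ∧
          (ν = 0 → Δ.pwConst v = 0) := by
  obtain ⟨C, hC, hmain⟩ := Inext.exists_norm_le_add_sum_norm_setIntegral hz0 hz1 hz
  -- With ρ = c₁δ, each of the three error terms will be at most c₁δ, so their sum times C is at
  -- most δ/3.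
  set c₁ := 1 / (9 * (C + 1)) with hc₁
  have hc₁0 : 0 < c₁ := by positivity
  have hc₁1 : c₁ ≤ 1 := by
    rw [hc₁, div_le_one (by positivity)]; linarith
  have hCc : C * (3 * c₁) ≤ 1 / 3 := by
    rw [hc₁, mul_one_div, mul_div_assoc', div_le_div_iff₀ (by positivity) (by positivity)]
    linarith
  set B := 2 * (1 + ∑ k, ‖z k‖) with hB
  have hSz : 0 ≤ ∑ k, ‖z k‖ := Finset.sum_nonneg fun k _ => norm_nonneg _
  have hB0 : 0 < B := by positivity
  set c := min (c₁ ^ 2 / 4) (1 / (4 * B)) with hc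
  have hc0 : 0 < c := by positivity
  have hcc₁ : c ≤ c₁ ^ 2 / 4 := min_le_left _ _
  have hcB : c ≤ 1 / (4 * B) := min_le_right _ _
  have hsq : c₁ ^ 2 ≤ c₁ := by nlinarith
  refine ⟨c, hc0, fun δ ε Δ a hδ0 hδ1 hε hcan _ => ?_⟩
  refine ⟨Inext.discreteProgram_isConvex Δ a, Inext.existsUnique_isInfExtremal hz hz0 hz1 _,
    Inext.exists_inextReturns Δ a, fun v hv => ⟨?_, fun ν hν => ?_⟩⟩
  · refine (Inext.infEquiv_iff hz0 hz1 hz).2 fun k => ?_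
    rw [Inext.integral_pwConst_mul_phi hz0 hz1, Inext.integral_pwConst_mul_phi hz0 hz1,
      ((Inext.inextReturns_iff Δ a v).1 hv).1]
  obtain ⟨⟨-, -, hmesh, ⟨N, r, hr, hpoly⟩, -⟩, -⟩ := hcan
  have hε2 : ε ≤ c * δ ^ 2 :=
    hε.trans (mul_le_mul_of_nonneg_left (pow_le_pow_of_le_one hδ0.le hδ1.le (by omega)) hc0.le)
  have hR4 : 1 / (4 * (c * δ)) ≤ r / 2 := by
    rw [show 1 / (4 * (c * δ)) = 1 / (c * δ) / 4 by field_simp]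
    linarith
  have hRB : B ≤ r / 2 := by
    refine le_trans ?_ hR4
    rw [le_div_iff₀ (by positivity)]
    rw [le_div_iff₀ (by positivity)] at hcB
    nlinarith [mul_pos hc0 hB0]
  have hR0 : 0 < r / 2 := hB0.trans_le hRB
  have hRinv : 1 / (r / 2) ≤ c₁ * δ := by
    rw [div_le_iff₀ hR0]
    rw [div_le_iff₀ (by positivity)] at hR4
    have : 4 * c ≤ c₁ := by linarith
    nlinarith [mul_pos hδ0 hR0]
  have hερ : ε / (c₁ * δ) ≤ c₁ * δ := by
    rw [div_le_iff₀ (by positivity)]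
    nlinarith [sq_nonneg δ, sq_nonneg (c₁ * δ)]
  have hερ' : ε ≤ c₁ * δ := by
    have h1 := (div_le_iff₀ (by positivity : 0 < c₁ * δ)).1 hερ
    have h2 : c₁ * δ ≤ 1 := mul_le_one₀ hc₁1 hδ0.le hδ1.le
    nlinarith [mul_pos hc₁0 hδ0]
  have hbound : ∀ x : Fin (n - 3) → ℂ, ∫ w, ‖Inext.comb z x w‖ ≤
      (1 + δ / 2) * ∑ s : Δ.Face, ‖∫ w in Δ.region s, Inext.comb z x w‖ := by
    intro x
    have h1 := hmain Δ ε (c₁ * δ) (r / 2) N (by positivity) hερ' hmesh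
      (fun k => by
        have := Finset.single_le_sum (f := fun k => ‖z k‖) (fun k _ => norm_nonneg _)
          (Finset.mem_univ k)
        linarith)
      (by rwa [mul_div_cancel₀ r two_ne_zero]) x
    set I := ∫ w, ‖Inext.comb z x w‖ with hI
    set S := ∑ s : Δ.Face, ‖∫ w in Δ.region s, Inext.comb z x w‖ with hS
    have hI0 : 0 ≤ I := MeasureTheory.integral_nonneg fun w => norm_nonneg _
    have h2 : C * (ε / (c₁ * δ) + c₁ * δ + 1 / (r / 2)) ≤ δ / 3 := by
      calc C * (ε / (c₁ * δ) + c₁ * δ + 1 / (r / 2)) ≤ C * (c₁ * δ + c₁ * δ + c₁ * δ) := by gcongr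
        _ = C * (3 * c₁) * δ := by ring
        _ ≤ 1 / 3 * δ := by gcongr
        _ = δ / 3 := by ring
    have h3 : (1 - δ / 3) * I ≤ S := by
      have := mul_le_mul_of_nonneg_right h2 hI0
      linarith
    have h4 : (1 + δ / 2) * ((1 - δ / 3) * I) ≤ (1 + δ / 2) * S := by gcongr
    -- The surplus in (1 + δ/2)(1 - δ/3) = 1 + δ(1 - δ)/6 ≥ 1. The factor 1 + δ/2, rather than 1 +
    -- δ, leaves room for the strict inequality.
    have h5 : 0 ≤ δ * (1 - δ) * I := mul_nonneg (mul_nonneg hδ0.le (by linarith)) hI0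
    nlinarith
  have hfin := Inext.norm_pwConst_le_of_inextReturns hz0 hz1 hv hz hν.1 (by positivity) hbound
  constructor
  · intro hne
    have : 0 < ‖ν‖ := norm_pos_iff.2 hne
    nlinarith
  · rintro rfl
    rw [norm_zero, mul_zero, norm_le_zero_iff] at hfin
    exact hfin
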